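/- Let $\Omega,\Lambda\subset\mathbb{R}^d$ be bounded convex sets with $\mathcal L^d(\Omega)=\mathcal L^d(\Lambda)$ and $B(0,1/r^*)\subset\Lambda\subset B(0,r^*/2)$ for some $r^*>1$; let $p\in(1,\infty)$ and $\frac1p+\frac1q=1$. Let $\mathcal S$ be a finite-dimensional linear subspace of $W^{1,q}_0(\Omega,\mathbb{R}^{d\times d})$. Matrices carry the Frobenius inner product and norm, $f^*(\eta)=\sup_\xi\{\xi\cdot\eta-f(\xi)\}\in(-\infty,\infty]$ is the Legendre transform, $\partial$ is the subdifferential, and $\operatorname{div}$ is the row-wise divergence. Let $f:\mathbb{R}^{d\times d}\to\mathbb{R}$ be convex and such that (i) there are $a,b,c>0$ with $a|\xi|-b\le f(\xi)\le c\frac{|\xi|^p}{p}+b$ and $|\xi^*|^q\le c|\xi|^p+b$ for all $\xi\in\mathbb{R}^{d\times d}$ and all $\xi^*\in\partial f(\xi)$; (ii) $\int_\Omega f^*(\varphi)$ is finite for some $\varphi\in\mathcal S$; (iii) either $f$ is strictly convex, or for every $\eta$ with $f^*(\eta)<\infty$ the set $\partial f^*(\eta)$ is non-empty and its element of minimal norm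 is $0$. Call a map $G:\Omega\to\mathbb{R}^d$ non-degenerate if $\mathcal L^d(G^{-1}(N))=0$ for every $N\subset\mathbb{R}^d$ with $\mathcal L^d(N)=0$. Let $F\in L^1(\Omega,\mathbb{R}^d)$ be non-degenerate, and suppose that for every $\varphi\in\mathcal S$ the gradient $\nabla\varphi$ has countable range (that is, takes values in a countable set almost everywhere on $\Omega$). Let $\mathscr U_{\mathcal S}$ be the set of measurable $u:\Omega\to\bar\Lambda$ for which there is a constant $\bar c>0$ with $\left|\int_\Omega u\cdot\operatorname{div}\varphi\right|\le\bar c\,\|\varphi\|_{L^q(\Omega)}$ for all $\varphi\in\mathcal S$, and let $$\mathscr U^1_{\mathcal S}=\Big\{u\in\mathscr U_{\mathcal S}:\ \int_\Omega l(u(x))\,dx=\int_\Lambda l(y)\,dy\quad\forall\, l\in C_c(\mathbb{R}^d)\Big\},\qquad V^f_{\mathcal S}(u)=\sup_{\varphi\in\mathcal S}\int_\Omega\big(-u\cdot\operatorname{div}\varphi-f^*(\varphi)\big)\,dx .$$ Then $F$ satisfies the condition $(\mathbf{ND})_{\mathcal S}$, that is, $F+\operatorname{div}\varphi$ is non-degenerate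 for every $\varphi\in\mathcal S$; and the problem $$\inf_{u\in\mathscr U^1_{\mathcal S}}\Big\{V^f_{\mathcal S}(u)-\int_\Omega F\cdot u\,dx\Big\}$$ admits a unique minimizer (unique up to equality almost everywhere on $\Omega$). -/

import Mathlib

open MeasureTheory Set Filter Topology
open scoped ENNReal ContDiff

noncomputable section

namespace PseudoGradient

/-- `ℝ^d` with the Euclidean norm. -/
abbrev Vec (d : ℕ) := EuclideanSpace ℝ (Fin d)

/-- `ℝ^{d×d}` with the Frobenius inner product `ξ · η = ∑ i j, ξ i j * η i j` and its norm. -/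
abbrev Mat (d : ℕ) := EuclideanSpace ℝ (Fin d × Fin d)

/-- Values of the gradient of a matrix field: linear maps `ℝ^d → ℝ^{d×d}`. -/
abbrev GradMat (d : ℕ) := Vec d →L[ℝ] Mat d

/-! ### Convex analysis -/

/-- The Legendre transform `f^*(ξ') = sup_ξ (ξ · ξ' - f ξ)`, with values in `(-∞, ∞]`. -/
def legendre {d : ℕ} (f : Mat d → ℝ) (η : Mat d) : EReal :=
  ⨆ ξ : Mat d, ((inner ℝ ξ η - f ξ : ℝ) : EReal)

/-- The subdifferential of an extended real valued function at `x`. -/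
def subdiff {d : ℕ} (h : Mat d → EReal) (x : Mat d) : Set (Mat d) :=
  {y | ∀ z, h x + ((inner ℝ y (z - x) : ℝ) : EReal) ≤ h z}

/-- `g = grad[h](x)`: `g` is the element of minimal norm of the subdifferential of `h` at `x`. -/
def IsMinNormSubgrad {d : ℕ} (h : Mat d → EReal) (x g : Mat d) : Prop :=
  g ∈ subdiff h x ∧ ∀ y ∈ subdiff h x, ‖g‖ ≤ ‖y‖

/-- The integral of an extended real valued function (positive part minus negative part). It is
used only for functions bounded below on sets of finite measure, so its value lies
in `(-∞, ∞]`. -/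
def extIntegral {α : Type*} [MeasurableSpace α] (μ : Measure α) (g : α → EReal) : EReal :=
  ((∫⁻ x, (g x).toENNReal ∂μ : ℝ≥0∞) : EReal) - ((∫⁻ x, (-g x).toENNReal ∂μ : ℝ≥0∞) : EReal)

/-! ### The Sobolev space `W_0^{1,q}(Ω, ℝ^{d×d})`

A Sobolev function is recorded as the pair `(φ, ∇φ)` of `L^q` classes on `Ω`, where `∇φ` is the
weak gradient (which is determined by `φ`). For open `Ω` the set `interior Ω` below is `Ω`. -/

/-- Pairs `(φ, G)` of `L^q` classes on `Ω`. Its topology is the one of the norm of `W^{1,q}`. -/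
abbrev LqPair (d : ℕ) (Ω : Set (Vec d)) (q : ℝ) :=
  Lp (Mat d) (ENNReal.ofReal q) (volume.restrict Ω) ×
    Lp (GradMat d) (ENNReal.ofReal q) (volume.restrict Ω)

/-- `G` is the weak gradient of `φ` in `Ω`: for all scalar `ψ ∈ C_c^∞(Ω)` and all directions `v`,
`∫ (∂_v ψ) φ = - ∫ ψ (G v)`. -/
def IsWeakGradient {d : ℕ} (Ω : Set (Vec d)) (φ : Vec d → Mat d) (G : Vec d → GradMat d) : Prop :=
  ∀ ψ : Vec d → ℝ, ContDiff ℝ ∞ ψ → HasCompactSupport ψ → tsupport ψ ⊆ interior Ω →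
    ∀ v : Vec d, ∫ x in Ω, fderiv ℝ ψ x v • φ x = - ∫ x in Ω, ψ x • G x v

lemma integrable_test_smul {d : ℕ} {Ω : Set (Vec d)} {q : ℝ} [h : Fact (1 ≤ ENNReal.ofReal q)]
    {E : Type*} [NormedAddCommGroup E] [NormedSpace ℝ E]
    {ψ : Vec d → ℝ} (hψ : Continuous ψ) (hc : HasCompactSupport ψ)
    (g : Lp E (ENNReal.ofReal q) (volume.restrict Ω)) :
    Integrable (fun x => ψ x • g x) (volume.restrict Ω) :=
  ((Lp.memLp g).locallyIntegrable h.out).integrable_smul_left_of_hasCompactSupport hψ hc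

lemma continuous_fderiv_apply {d : ℕ} {ψ : Vec d → ℝ} (hψ : ContDiff ℝ ∞ ψ) (v : Vec d) :
    Continuous fun x => fderiv ℝ ψ x v :=
  (hψ.continuous_fderiv (by simp)).clm_apply continuous_const

/-- `W^{1,q}(Ω, ℝ^{d×d})`, as the space of pairs `(φ, ∇φ)`. -/
def sobolev (d : ℕ) (Ω : Set (Vec d)) (q : ℝ) [Fact (1 ≤ ENNReal.ofReal q)] :
    Submodule ℝ (LqPair d Ω q) where
  carrier := {P | IsWeakGradient Ω P.1 P.2}
  zero_mem' := by
    intro ψ _ _ _ v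
    have h1 : ∀ᵐ x ∂(volume.restrict Ω), fderiv ℝ ψ x v • (0 : LqPair d Ω q).1 x = 0 := by
      filter_upwards [Lp.coeFn_zero (Mat d) (ENNReal.ofReal q) (volume.restrict Ω)] with x hx
      rw [Prod.fst_zero, hx, Pi.zero_apply, smul_zero]
    have h2 : ∀ᵐ x ∂(volume.restrict Ω), ψ x • (0 : LqPair d Ω q).2 x v = 0 := by
      filter_upwards [Lp.coeFn_zero (GradMat d) (ENNReal.ofReal q) (volume.restrict Ω)] with x hx
      rw [Prod.snd_zero, hx, Pi.zero_apply, zero_apply, smul_zero]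
    rw [integral_eq_zero_of_ae h1, integral_eq_zero_of_ae h2, neg_zero]
  add_mem' := by
    intro P Q hP hQ ψ hψ hc hs v
    have h1 : ∀ᵐ x ∂(volume.restrict Ω), fderiv ℝ ψ x v • (P + Q).1 x
        = fderiv ℝ ψ x v • P.1 x + fderiv ℝ ψ x v • Q.1 x := by
      filter_upwards [Lp.coeFn_add P.1 Q.1] with x hx
      rw [Prod.fst_add, hx, Pi.add_apply, smul_add]
    have h2 : ∀ᵐ x ∂(volume.restrict Ω), ψ x • (P + Q).2 x v
        = ψ x • P.2 x v + ψ x • Q.2 x v := by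
      filter_upwards [Lp.coeFn_add P.2 Q.2] with x hx
      rw [Prod.snd_add, hx, Pi.add_apply, add_apply, smul_add]
    have hD := continuous_fderiv_apply hψ v
    have hDc : HasCompactSupport fun x => fderiv ℝ ψ x v :=
      hc.fderiv_apply (𝕜 := ℝ) v
    have hi : ∀ R : LqPair d Ω q,
        Integrable (fun x => ψ x • R.2 x v) (volume.restrict Ω) := fun R =>
      (integrable_test_smul hψ.continuous hc R.2).apply_continuousLinearMap v
    rw [integral_congr_ae h1, integral_congr_ae h2,
      integral_add (integrable_test_smul hD hDc P.1) (integrable_test_smul hD hDc Q.1),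
      integral_add (hi P) (hi Q), hP ψ hψ hc hs v, hQ ψ hψ hc hs v, neg_add]
  smul_mem' := by
    intro c P hP ψ hψ hc hs v
    have h1 : ∀ᵐ x ∂(volume.restrict Ω), fderiv ℝ ψ x v • (c • P).1 x
        = c • (fderiv ℝ ψ x v • P.1 x) := by
      filter_upwards [Lp.coeFn_smul c P.1] with x hx
      rw [Prod.smul_fst, hx, Pi.smul_apply, smul_comm]
    have h2 : ∀ᵐ x ∂(volume.restrict Ω), ψ x • (c • P).2 x v = c • (ψ x • P.2 x v) := by
      filter_upwards [Lp.coeFn_smul c P.2] with x hx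
      rw [Prod.smul_snd, hx, Pi.smul_apply, smul_apply, smul_comm]
    rw [integral_congr_ae h1, integral_congr_ae h2, integral_smul, integral_smul,
      hP ψ hψ hc hs v, smul_neg]

/-- The pairs `(φ, ∇φ)` with `φ ∈ C_c^∞(Ω, ℝ^{d×d})`. -/
def testPairs (d : ℕ) (Ω : Set (Vec d)) (q : ℝ) [Fact (1 ≤ ENNReal.ofReal q)] :
    Submodule ℝ (LqPair d Ω q) where
  carrier := {P | ∃ φ : Vec d → Mat d, ContDiff ℝ ∞ φ ∧ HasCompactSupport φ ∧
    tsupport φ ⊆ interior Ω ∧ P.1 =ᵐ[volume.restrict Ω] φ ∧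
    P.2 =ᵐ[volume.restrict Ω] fderiv ℝ φ}
  zero_mem' := by
    refine ⟨fun _ => 0, contDiff_const, HasCompactSupport.zero, ?_, Lp.coeFn_zero _ _ _, ?_⟩
    · simp [tsupport]
    · filter_upwards [Lp.coeFn_zero (GradMat d) (ENNReal.ofReal q) (volume.restrict Ω)] with x hx
      rw [Prod.snd_zero, hx]
      simp
  add_mem' := by
    rintro P Q ⟨φ, hφ, hφc, hφs, hφ1, hφ2⟩ ⟨χ, hχ, hχc, hχs, hχ1, hχ2⟩
    refine ⟨φ + χ, hφ.add hχ, hφc.add hχc,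
      (tsupport_add φ χ).trans (union_subset hφs hχs), ?_, ?_⟩
    · filter_upwards [Lp.coeFn_add P.1 Q.1, hφ1, hχ1] with x hx h1 h2
      rw [Prod.fst_add, hx, Pi.add_apply, Pi.add_apply, h1, h2]
    · filter_upwards [Lp.coeFn_add P.2 Q.2, hφ2, hχ2] with x hx h1 h2
      rw [Prod.snd_add, hx, Pi.add_apply, h1, h2,
        fderiv_add (hφ.differentiable (by simp) x) (hχ.differentiable (by simp) x)]
  smul_mem' := by
    rintro c P ⟨φ, hφ, hφc, hφs, hφ1, hφ2⟩
    refine ⟨c • φ, hφ.const_smul c, hφc.smul_left (f := fun _ => c),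
      (closure_mono (Function.support_const_smul_subset c φ)).trans hφs, ?_, ?_⟩
    · filter_upwards [Lp.coeFn_smul c P.1, hφ1] with x hx h1
      rw [Prod.smul_fst, hx, Pi.smul_apply, Pi.smul_apply, h1]
    · filter_upwards [Lp.coeFn_smul c P.2, hφ2] with x hx h1
      rw [Prod.smul_snd, hx, Pi.smul_apply, h1,
        fderiv_const_smul (hφ.differentiable (by simp) x)]

/-- `W_0^{1,q}(Ω, ℝ^{d×d})`: the closure of `C_c^∞(Ω, ℝ^{d×d})` in `W^{1,q}(Ω, ℝ^{d×d})`. -/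
def sobolevZero (d : ℕ) (Ω : Set (Vec d)) (q : ℝ) [Fact (1 ≤ ENNReal.ofReal q)] :
    Submodule ℝ (LqPair d Ω q) :=
  sobolev d Ω q ⊓ (testPairs d Ω q).topologicalClosure

section Sobolev

variable {d : ℕ} {Ω : Set (Vec d)} {q : ℝ} [Fact (1 ≤ ENNReal.ofReal q)]

/-- (A representative of) the matrix field `φ` itself. -/
def field (φ : sobolevZero d Ω q) : Vec d → Mat d := φ.1.1

/-- (A representative of) the gradient `∇φ`; `grad φ x v` is the derivative of `φ` at `x` in
direction `v`. -/
def grad (φ : sobolevZero d Ω q) : Vec d → GradMat d := φ.1.2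

/-- The row-wise divergence `(div φ)_i = ∑ j, ∂_j φ_{ij}`. -/
def divergence (φ : sobolevZero d Ω q) (x : Vec d) : Vec d :=
  WithLp.toLp 2 fun i => ∑ j, grad φ x (EuclideanSpace.single j 1) (i, j)

/-- `∇φ` has a countable range (as an almost everywhere defined map on `Ω`). -/
def HasCountableGradRange (φ : sobolevZero d Ω q) : Prop :=
  ∃ C : Set (GradMat d), C.Countable ∧ ∀ᵐ x ∂(volume.restrict Ω), grad φ x ∈ C

/-- `∫_Ω f^*(φ)`. -/
def conjEnergy (f : Mat d → ℝ) (φ : sobolevZero d Ω q) : EReal :=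
  extIntegral (volume.restrict Ω) fun x => legendre f (field φ x)

/-- `G : Ω → ℝ^d` is non-degenerate: preimages of Lebesgue null sets are Lebesgue null sets. -/
def NonDegenerate (Ω : Set (Vec d)) (G : Vec d → Vec d) : Prop :=
  ∀ N : Set (Vec d), volume N = 0 → volume (Ω ∩ G ⁻¹' N) = 0

/-- The condition `(ND)_S`: `F + div φ` is non-degenerate for every `φ ∈ S`. -/
def ConditionND (F : Vec d → Vec d) (S : Set (sobolevZero d Ω q)) : Prop :=
  ∀ φ ∈ S, NonDegenerate Ω fun x => F x + divergence φ x

/-- The standing assumption on `f` (relative to `S` and the exponents `p`, `q`). -/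
structure ConditionA1 (p : ℝ) (f : Mat d → ℝ) (S : Set (sobolevZero d Ω q)) : Prop where
  convex : ConvexOn ℝ univ f
  growth : ∃ a b c : ℝ, 0 < a ∧ 0 < b ∧ 0 < c ∧
    (∀ ξ : Mat d, a * ‖ξ‖ - b ≤ f ξ ∧ f ξ ≤ c * (‖ξ‖ ^ p / p) + b) ∧
    ∀ ξ : Mat d, ∀ η ∈ subdiff (fun ζ => (f ζ : EReal)) ξ, ‖η‖ ^ q ≤ c * ‖ξ‖ ^ p + b
  exists_finite : ∃ φ ∈ S, conjEnergy f φ ≠ ⊤ ∧ conjEnergy f φ ≠ ⊥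
  strict_or_flat : StrictConvexOn ℝ univ f ∨
    ∀ η : Mat d, legendre f η ≠ ⊤ → IsMinNormSubgrad (legendre f) η 0

/-- The set `𝒰_S` of measurable `u : Ω → closure Λ` for which there is a constant `c` with
`|∫ u · div φ| ≤ c ‖φ‖_{L^q}` for all `φ ∈ S`. Only the values of `u` on `Ω` matter. -/
def displacements (Λ : Set (Vec d)) (S : Set (sobolevZero d Ω q)) : Set (Vec d → Vec d) :=
  {u | AEMeasurable u (volume.restrict Ω) ∧ (∀ x ∈ Ω, u x ∈ closure Λ) ∧
    ∃ c : ℝ, 0 < c ∧ ∀ φ ∈ S, |∫ x in Ω, inner ℝ (u x) (divergence φ x)| ≤ c * ‖φ.1.1‖}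

/-- The set `𝒰_S^1` of incompressible (measure preserving) displacements. -/
def incompressible (Λ : Set (Vec d)) (S : Set (sobolevZero d Ω q)) : Set (Vec d → Vec d) :=
  {u | u ∈ displacements Λ S ∧ ∀ l : Vec d → ℝ, Continuous l → HasCompactSupport l →
    ∫ x in Ω, l (u x) = ∫ y in Λ, l y}

/-- `V_S^f(u) = sup_{φ ∈ S} (- ∫ u · div φ - ∫ f^*(φ))`. -/
def pseudoEnergy (f : Mat d → ℝ) (S : Set (sobolevZero d Ω q)) (u : Vec d → Vec d) : EReal :=
  ⨆ φ ∈ S, (((- ∫ x in Ω, inner ℝ (u x) (divergence φ x) : ℝ) : EReal) - conjEnergy f φ)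

/-- `I_0(u) = V_S^f(u) - ∫ F · u`. -/
def energy (f : Mat d → ℝ) (F : Vec d → Vec d) (S : Set (sobolevZero d Ω q))
    (u : Vec d → Vec d) : EReal :=
  pseudoEnergy f S u - ((∫ x in Ω, inner ℝ (F x) (u x) : ℝ) : EReal)

/-- `u` is a solution of the problem `inf {I_0(u) : u ∈ 𝒰_S^1}`. -/
def IsIncompressibleMinimizer (Λ : Set (Vec d)) (f : Mat d → ℝ) (F : Vec d → Vec d)
    (S : Set (sobolevZero d Ω q)) (u : Vec d → Vec d) : Prop :=
  u ∈ incompressible Λ S ∧ ∀ v ∈ incompressible Λ S, energy f F S u ≤ energy f F S v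

end Sobolev

end PseudoGradient

end

open PseudoGradient

/-! Condition `(ND)_S`: where `∇φ` equals a fixed matrix, `F + div φ` is a translate of `F`.
Countably many such pieces cover `Ω` up to a null set, and Lebesgue measure is translation
invariant.

Minimizer: the problem is solved through its dual, which minimizes `J(ψ, φ) = ∫_Ω ψ(F + div φ) + ∫_Λ
ψ^* + ∫_Ω f^*(φ)` over `φ ∈ S` and `r^*/2`-Lipschitz `ψ` with `ψ 0 = 0`. A minimizer exists by the
direct method (`exists_isDualMinimizer`). Since `f` is bounded above on balls, `f^*` is superlinear,
which beats the linear growth of the first term and bounds the finite-dimensional variable `φ`;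
normalized Lipschitz functions are compact for pointwise convergence; Fatou's lemma gives lower
semicontinuity.

At a minimizer put `u = ∇ψ(F + div φ)`, defined almost everywhere by Rademacher's theorem and
non-degeneracy. Varying `ψ^*` shows that `u` pushes `Ω` forward to `Λ`
(`IsDualPotential.map_gradient`). Varying `φ` shows that `φ` attains the supremum `V(u)`
(`IsDualMinimizer.sub_le`). By the Fenchel inequality and its equality case, `u` is the unique
maximizer of `∫ (F + div φ) · v` among measure preserving `v` (`integral_inner_le_and_eq`). Testing
`V(v)` with this `φ` gives `V(v) - ∫ F·v ≥ -∫ f^*(φ) - ∫ (F + div φ)·v ≥ -∫ f^*(φ) - ∫ (F + div φ)·u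
= V(u) - ∫ F·u`, and equality forces `v = u` almost everywhere. -/

set_option linter.unusedSectionVars false

namespace PseudoGradient

open scoped NNReal RealInnerProductSpace Gradient BoundedContinuousFunction

/-! ### Conjugates, approximate subgradients and derivatives of suprema -/

section Conjugate

variable {E : Type*} [NormedAddCommGroup E] [InnerProductSpace ℝ E]

/-- The positive part of the Legendre transform of `ψ`. It is the Legendre transform itself
if `ψ 0 = 0`. -/
noncomputable def conj (ψ : E → ℝ) (y : E) : ℝ≥0∞ := ⨆ x, ENNReal.ofReal (⟪x, y⟫ - ψ x)

lemma lowerSemicontinuous_conj (ψ : E → ℝ) : LowerSemicontinuous (conj ψ) :=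
  lowerSemicontinuous_iSup fun x =>
    (ENNReal.continuous_ofReal.comp (by fun_prop)).lowerSemicontinuous

lemma measurable_conj [MeasurableSpace E] [BorelSpace E] (ψ : E → ℝ) : Measurable (conj ψ) :=
  (lowerSemicontinuous_conj ψ).measurable

lemma inner_sub_le_toReal_conj {ψ : E → ℝ} {y : E} (hy : conj ψ y ≠ ⊤) (x : E) :
    ⟪x, y⟫ - ψ x ≤ (conj ψ y).toReal :=
  (ENNReal.ofReal_le_iff_le_toReal hy).1 (le_iSup (fun x => ENNReal.ofReal (⟪x, y⟫ - ψ x)) x)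

lemma conj_le_liminf {ψs : ℕ → E → ℝ} {ψ : E → ℝ}
    (h : ∀ x, Tendsto (fun n => ψs n x) atTop (𝓝 (ψ x))) (y : E) :
    conj ψ y ≤ liminf (fun n => conj (ψs n) y) atTop := by
  refine iSup_le fun x => ?_
  have ht : Tendsto (fun n => ENNReal.ofReal (⟪x, y⟫ - ψs n x)) atTop
      (𝓝 (ENNReal.ofReal (⟪x, y⟫ - ψ x))) :=
    (ENNReal.continuous_ofReal.tendsto _).comp (tendsto_const_nhds.sub (h x))
  rw [← ht.liminf_eq]
  exact liminf_le_liminf (Eventually.of_forall fun n =>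
    le_iSup (fun x => ENNReal.ofReal (⟪x, y⟫ - ψs n x)) x)

/-- Fenchel's equality at a subgradient. -/
lemma conj_eq_of_subgradient {ψ : E → ℝ} {x g : E}
    (h : ∀ x', ⟪x' - x, g⟫ ≤ ψ x' - ψ x) : conj ψ g = ENNReal.ofReal (⟪x, g⟫ - ψ x) := by
  refine le_antisymm (iSup_le fun x' => ENNReal.ofReal_le_ofReal ?_)
    (le_iSup (fun x => ENNReal.ofReal (⟪x, g⟫ - ψ x)) x)
  have := h x'
  rw [inner_sub_left] at this
  linarith

/-- Pointwise sequential compactness of normalized Lipschitz functions. -/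
lemma exists_subseq_tendsto_of_lipschitz {X : Type*} [PseudoMetricSpace X]
    [TopologicalSpace.SeparableSpace X] {R : ℝ≥0} {ψs : ℕ → X → ℝ} (z : X)
    (hL : ∀ n, LipschitzWith R (ψs n)) (h0 : ∀ n, ψs n z = 0) :
    ∃ ψ : X → ℝ, LipschitzWith R ψ ∧ ψ z = 0 ∧ ∃ s : ℕ → ℕ, StrictMono s ∧
      ∀ x, Tendsto (fun n => ψs (s n) x) atTop (𝓝 (ψ x)) := by
  have : Nonempty X := ⟨z⟩
  let e := TopologicalSpace.denseSeq X
  -- Values on a dense sequence lie in a countable product of compact intervals, which replaces a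
  -- diagonal extraction; equicontinuity then extends convergence to every point.
  have hK : IsCompact (Set.pi univ fun j : ℕ => Icc (-(R * dist (e j) z)) (R * dist (e j) z)) :=
    isCompact_univ_pi fun j => isCompact_Icc
  have hmem : ∀ n, (fun j => ψs n (e j)) ∈
      Set.pi univ fun j : ℕ => Icc (-(R * dist (e j) z)) (R * dist (e j) z) := by
    intro n j _
    have := (hL n).dist_le_mul (e j) z
    rw [h0, Real.dist_eq, sub_zero] at this
    exact abs_le.1 this
  obtain ⟨a, -, s, hs, ha⟩ := hK.tendsto_subseq hmem
  have hconv : ∀ j, Tendsto (fun n => ψs (s n) (e j)) atTop (𝓝 (a j)) := fun j =>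
    (tendsto_pi_nhds.1 ha j)
  have hlim : ∀ x, ∃ t, Tendsto (fun n => ψs (s n) x) atTop (𝓝 t) := by
    intro x
    refine cauchySeq_tendsto_of_complete (Metric.cauchySeq_iff'.2 fun ε hε => ?_)
    obtain ⟨j, hj⟩ : ∃ j, dist x (e j) < ε / (4 * (R + 1)) := by
      have := (TopologicalSpace.denseRange_denseSeq X).exists_dist_lt x
        (ε := ε / (4 * (R + 1))) (by positivity)
      exact this
    have hRj : R * dist x (e j) ≤ ε / 4 := by
      have h1 : (R : ℝ) * dist x (e j) ≤ (R + 1) * (ε / (4 * (R + 1))) :=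
        mul_le_mul (by linarith) hj.le dist_nonneg (by positivity)
      have h2 : ((R : ℝ) + 1) * (ε / (4 * (R + 1))) = ε / 4 := by field_simp
      linarith
    obtain ⟨N, hN⟩ := Metric.cauchySeq_iff'.1 (hconv j).cauchySeq (ε / 2) (by positivity)
    refine ⟨N, fun n hn => ?_⟩
    have h1 := (hL (s n)).dist_le_mul x (e j)
    have h2 := (hL (s N)).dist_le_mul (e j) x
    rw [dist_comm (e j) x] at h2
    have h3 := hN n hn
    have h4 := dist_triangle4 (ψs (s n) x) (ψs (s n) (e j)) (ψs (s N) (e j)) (ψs (s N) x)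
    linarith
  choose ψ hψ using hlim
  refine ⟨ψ, LipschitzWith.of_dist_le_mul fun x y => ?_, ?_, s, hs, hψ⟩
  · exact le_of_tendsto ((hψ x).dist (hψ y))
      (Eventually.of_forall fun n => (hL (s n)).dist_le_mul x y)
  · refine tendsto_nhds_unique (hψ z) ?_
    simp [h0]

/-- Approximate subgradients at a point of differentiability are close to the gradient. -/
lemma norm_sub_gradient_le [CompleteSpace E] {ψ : E → ℝ} {x g : E} (h : HasGradientAt ψ g x)
    {η : ℝ} (hη : 0 < η) :
    ∃ δ > 0, ∀ (y : E) (s : ℝ), (∀ x', ⟪x' - x, y⟫ ≤ ψ x' - ψ x + s) → ‖y - g‖ ≤ η + s / δ := by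
  have h1 := hasGradientAt_iff_isLittleO.1 h
  obtain ⟨δ, hδ, hd⟩ := Metric.eventually_nhds_iff.1 (h1.def hη)
  refine ⟨δ / 2, by positivity, fun y s hs => ?_⟩
  by_cases hyg : y - g = 0
  · have := hs x
    simp only [sub_self, inner_zero_left, zero_add] at this
    rw [hyg, norm_zero]
    positivity
  have hn : 0 < ‖y - g‖ := norm_pos_iff.2 hyg
  set v : E := (δ / 2 / ‖y - g‖) • (y - g)
  have hv : ‖v‖ = δ / 2 := by
    rw [norm_smul, Real.norm_of_nonneg (by positivity)]
    field_simp
  have h2 := hd (y := x + v) (by rw [dist_eq_norm, add_sub_cancel_left, hv]; linarith)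
  have h3 := hs (x + v)
  rw [add_sub_cancel_left] at h2 h3
  rw [hv] at h2
  have h4 := (abs_le.1 h2).2
  have h5 : ⟪v, y⟫ - ⟪g, v⟫ = δ / 2 * ‖y - g‖ := by
    rw [real_inner_comm v g, ← inner_sub_right, real_inner_smul_left, real_inner_self_eq_norm_sq]
    field_simp
  have h6 : δ / 2 * ‖y - g‖ ≤ δ / 2 * (η + s / (δ / 2)) := by
    have : δ / 2 * (η + s / (δ / 2)) = η * (δ / 2) + s := by field_simp
    linarith
  exact le_of_mul_le_mul_left h6 (by positivity)

lemma eq_gradient_of_subgradient [CompleteSpace E] {ψ : E → ℝ} {x g y : E}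
    (h : HasGradientAt ψ g x) (hy : ∀ x', ⟪x' - x, y⟫ ≤ ψ x' - ψ x) : y = g := by
  rw [← sub_eq_zero, ← norm_le_zero_iff]
  refine le_of_forall_pos_le_add fun η hη => ?_
  obtain ⟨δ, -, hd⟩ := norm_sub_gradient_le h hη
  simpa using hd y 0 (by simpa using hy)

/-- `sup_{y ∈ D} (⟪x, y⟫ - k y)`. -/
noncomputable def supTransform (D : Set E) (k : E → ℝ) (x : E) : ℝ := ⨆ y : D, (⟪x, (y : E)⟫ - k y)

variable {D : Set E} {k : E → ℝ} {ψ : E → ℝ}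

/-- A real supremum over an unbounded family is `0` by convention, so the upper bound `hb`
accompanies the statements that need the supremum to dominate its terms. -/
lemma le_supTransform {z : E} {B : ℝ} (hb : ∀ y ∈ D, ⟪z, y⟫ - k y ≤ B) {y : E}
    (hy : y ∈ D) : ⟪z, y⟫ - k y ≤ supTransform D k z :=
  le_ciSup (f := fun y : D => ⟪z, (y : E)⟫ - k y) ⟨B, by rintro _ ⟨y, rfl⟩; exact hb y y.2⟩ ⟨y, hy⟩

lemma supTransform_le (hD : D.Nonempty) {z : E} {b : ℝ} (hb : ∀ y ∈ D, ⟪z, y⟫ - k y ≤ b) :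
    supTransform D k z ≤ b := by
  have := hD.to_subtype
  exact ciSup_le fun y => hb y y.2

lemma exists_lt_of_lt_supTransform (hD : D.Nonempty) {z : E} {b : ℝ}
    (hb : b < supTransform D k z) : ∃ y ∈ D, b < ⟪z, y⟫ - k y := by
  have := hD.to_subtype
  obtain ⟨y, hy⟩ := exists_lt_of_lt_ciSup hb
  exact ⟨y, y.2, hy⟩

lemma lipschitzWith_supTransform (hD : D.Nonempty) {R : ℝ≥0} (hR : ∀ y ∈ D, ‖y‖ ≤ R)
    {B : E → ℝ} (hb : ∀ z, ∀ y ∈ D, ⟪z, y⟫ - k y ≤ B z) : LipschitzWith R (supTransform D k) := by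
  refine LipschitzWith.of_le_add_mul _ fun x z => supTransform_le hD fun y hy => ?_
  have h1 := le_supTransform (hb z) hy
  have h2 : ⟪x, y⟫ = ⟪z, y⟫ + ⟪x - z, y⟫ := by rw [inner_sub_left]; ring
  have h3 : ⟪x - z, y⟫ ≤ R * dist x z := by
    rw [dist_eq_norm, mul_comm]
    exact (real_inner_le_norm _ _).trans (mul_le_mul_of_nonneg_left (hR y hy) (norm_nonneg _))
  linarith

lemma supTransform_le_add (hD : D.Nonempty) {k' : E → ℝ} {z : E} {B c : ℝ}
    (hb : ∀ y ∈ D, ⟪z, y⟫ - k' y ≤ B) (hkk : ∀ y ∈ D, k' y ≤ k y + c) :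
    supTransform D k z ≤ supTransform D k' z + c :=
  supTransform_le hD fun y hy => by linarith [le_supTransform hb hy, hkk y hy]

/-- The transform of `k + ε l` has derivative `-l (∇ψ x)` in `ε` at `0`. -/
lemma hasDerivAt_supTransform [CompleteSpace E] (hD : D.Nonempty) {x g : E}
    (hb : ∀ z, ∀ y ∈ D, ⟪z, y⟫ - k y ≤ ψ z) (hx : supTransform D k x = ψ x)
    (hg : HasGradientAt ψ g x) {l : E → ℝ} (hl : ContinuousAt l g) {L : ℝ} (hL : ∀ y, |l y| ≤ L) :
    HasDerivAt (fun ε : ℝ => supTransform D (fun y => k y + ε * l y) x) (-l g) 0 := by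
  have hL0 : 0 ≤ L := (abs_nonneg _).trans (hL g)
  have hεl : ∀ (ε : ℝ) y, |ε * l y| ≤ |ε| * L := fun ε y => by
    rw [abs_mul]; exact mul_le_mul_of_nonneg_left (hL y) (abs_nonneg _)
  have hbε : ∀ (ε : ℝ), ∀ y ∈ D, ⟪x, y⟫ - (k y + ε * l y) ≤ ψ x + |ε| * L := fun ε y hy => by
    linarith [hb x y hy, (abs_le.1 (hεl ε y)).1]
  rw [hasDerivAt_iff_isLittleO, Asymptotics.isLittleO_iff]
  intro c hc
  obtain ⟨ρ, hρ, hlρ⟩ := Metric.continuousAt_iff.1 hl (c / 2) (by positivity)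
  obtain ⟨δ, hδ, hd⟩ := norm_sub_gradient_le hg (show 0 < ρ / 2 by positivity)
  -- `2 * L + c / 2` collects three losses for a near-maximizer `y` of the perturbed supremum: `L`
  -- since that supremum may be smaller than `ψ x`, `L` for removing `ε * l y`, and `c / 2` for not
  -- attaining it.
  have hsmall : ∀ᶠ ε : ℝ in 𝓝 0, (2 * L + c / 2) * |ε| < ρ / 2 * δ := by
    have ht : Tendsto (fun ε : ℝ => (2 * L + c / 2) * |ε|) (𝓝 0) (𝓝 ((2 * L + c / 2) * |0|)) :=
      (continuous_const.mul continuous_abs).tendsto 0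
    rw [abs_zero, mul_zero] at ht
    exact ht.eventually_lt_const (by positivity)
  filter_upwards [hsmall] with ε hε
  simp only [zero_mul, add_zero, sub_zero, smul_eq_mul, Real.norm_eq_abs]
  rw [hx]
  rcases eq_or_ne ε 0 with rfl | hε0
  · simp [hx]
  have hεp : 0 < |ε| := abs_pos.2 hε0
  -- Envelope argument without attained suprema: near-maximizers are approximate subgradients, hence
  -- close to `g`, where `l` is nearly `l g`.
  have key : ∀ y ∈ D, ψ x - (2 * L + c / 2) * |ε| ≤ ⟪x, y⟫ - k y → |ε * (l y - l g)| ≤ c / 2 * |ε| := by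
    intro y hy hyx
    have h1 : ‖y - g‖ ≤ ρ / 2 + (2 * L + c / 2) * |ε| / δ := by
      refine hd y _ fun x' => ?_
      rw [inner_sub_left]
      linarith [hb x' y hy]
    have h2 : (2 * L + c / 2) * |ε| / δ < ρ / 2 := (div_lt_iff₀ hδ).2 hε
    have h3 := (hlρ (x := y) (by rw [dist_eq_norm]; linarith)).le
    rw [Real.dist_eq] at h3
    rw [abs_mul, mul_comm]
    exact mul_le_mul_of_nonneg_right h3 hεp.le
  set T := supTransform D (fun y => k y + ε * l y) x with hT
  have hlow : ψ x - |ε| * L ≤ T := by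
    have := supTransform_le_add (k := k) (c := |ε| * L) hD (hbε ε)
      fun y _ => by linarith [(abs_le.1 (hεl ε y)).2]
    linarith
  -- A near-maximizer of the perturbed problem bounds `T` from above, one of the unperturbed problem
  -- from below.
  obtain ⟨y, hy, hyT⟩ := exists_lt_of_lt_supTransform hD
    (show T - c / 2 * |ε| < T by nlinarith)
  obtain ⟨y', hy', hyT'⟩ := exists_lt_of_lt_supTransform hD
    (show ψ x - c / 2 * |ε| < supTransform D k x by rw [hx]; nlinarith)
  have k1 := abs_le.1 (key y hy (by nlinarith [(abs_le.1 (hεl ε y)).1, (abs_le.1 (hεl ε y)).2]))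
  have k2 := abs_le.1 (key y' hy' (by nlinarith))
  have k3 := le_supTransform (hbε ε) hy'
  rw [← hT] at k3
  have := hb x y hy
  rw [abs_le]
  constructor <;> linarith

end Conjugate

/-! ### Optimal potentials and transport by their gradients -/

section DualPotential

variable {E : Type*} [NormedAddCommGroup E] [InnerProductSpace ℝ E] [FiniteDimensional ℝ E]
  [MeasurableSpace E] [BorelSpace E] {α : Type*} [MeasurableSpace α] {μ : Measure α}
  [IsFiniteMeasure μ] {ν : Measure E} [IsFiniteMeasure ν] {G : α → E} {R : ℝ≥0} {ψ : E → ℝ}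

lemma integrable_comp_of_lipschitzWith (hψ : LipschitzWith R ψ) (hG : Integrable G μ) :
    Integrable (fun x => ψ (G x)) μ := by
  refine ((integrable_const |ψ 0|).add (hG.norm.const_mul R)).mono'
    (hψ.continuous.comp_aestronglyMeasurable hG.1) (Eventually.of_forall fun x => ?_)
  have h := hψ.dist_le_mul (G x) 0
  rw [Real.dist_eq, dist_zero_right] at h
  have h2 := abs_sub_abs_le_abs_sub (ψ (G x)) (ψ 0)
  simp only [Real.norm_eq_abs, Pi.add_apply]
  linarith

lemma measurable_gradient (ψ : E → ℝ) : Measurable (∇ ψ) :=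
  (InnerProductSpace.toDual ℝ E).symm.continuous.measurable.comp (measurable_fderiv ℝ ψ)

/-- Rademacher's theorem makes the exceptional set null, and non-degeneracy keeps its preimage null.
Non-degeneracy enters the duality argument only here. -/
lemma ae_hasGradientAt (hψ : LipschitzWith R ψ)
    (hnd : ∀ N : Set E, Measure.addHaar N = 0 → μ (G ⁻¹' N) = 0) :
    ∀ᵐ x ∂μ, HasGradientAt ψ (∇ ψ (G x)) (G x) := by
  have h := hψ.ae_differentiableAt (μ := Measure.addHaar)
  filter_upwards [show ∀ᵐ x ∂μ, DifferentiableAt ℝ ψ (G x) from hnd _ h] with x hx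
  exact hx.hasGradientAt

/-- The set where the Legendre transform of `ψ` is finite. -/
def conjDomain (ψ : E → ℝ) (Λ : Set E) : Set E := {y | y ∈ Λ ∧ conj ψ y ≠ ⊤}

/-- `ψ` minimizes `∫ ψ(G) dμ + ∫ ψ^* dν` among the `R`-Lipschitz functions vanishing at `0`. -/
structure IsDualPotential (μ : Measure α) (ν : Measure E) (G : α → E) (R : ℝ≥0) (ψ : E → ℝ) :
    Prop where
  lipschitz : LipschitzWith R ψ
  map_zero : ψ 0 = 0
  finite : ∫⁻ y, conj ψ y ∂ν ≠ ⊤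
  le : ∀ χ : E → ℝ, LipschitzWith R χ → χ 0 = 0 → ∫⁻ y, conj χ y ∂ν ≠ ⊤ →
    ∫ x, ψ (G x) ∂μ + (∫⁻ y, conj ψ y ∂ν).toReal ≤ ∫ x, χ (G x) ∂μ + (∫⁻ y, conj χ y ∂ν).toReal

variable {Λ : Set E}

lemma ae_mem_conjDomain (hΛ : ∀ᵐ y ∂ν, y ∈ Λ) (h : ∫⁻ y, conj ψ y ∂ν ≠ ⊤) :
    ∀ᵐ y ∂ν, y ∈ conjDomain ψ Λ := by
  filter_upwards [hΛ, ae_lt_top (measurable_conj ψ) h] with y h1 h2 using ⟨h1, h2.ne⟩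

lemma conjDomain_bound (z : E) : ∀ y ∈ conjDomain ψ Λ, ⟪z, y⟫ - (conj ψ y).toReal ≤ ψ z :=
  fun _ hy => by linarith [inner_sub_le_toReal_conj hy.2 z]

/-- First variation of the dual functional in the potential. -/
lemma IsDualPotential.integral_le (h : IsDualPotential μ ν G R ψ) (hG : Integrable G μ)
    (hμν : ν univ = μ univ) (hΛ : ∀ᵐ y ∂ν, y ∈ Λ) (hΛR : ∀ y ∈ Λ, ‖y‖ ≤ R)
    (hD : (conjDomain ψ Λ).Nonempty) (l : E →ᵇ ℝ) :
    ∫ x, ψ (G x) ∂μ ≤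
      ∫ x, supTransform (conjDomain ψ Λ) (fun y => (conj ψ y).toReal + l y) (G x) ∂μ
        + ∫ y, l y ∂ν := by
  set D := conjDomain ψ Λ with hDdef
  set k : E → ℝ := fun y => (conj ψ y).toReal with hk
  set χ := supTransform D (fun y => k y + l y) with hχ
  have hb : ∀ z, ∀ y ∈ D, ⟪z, y⟫ - (k y + l y) ≤ ψ z + ‖l‖ := fun z y hy => by
    have h1 := conjDomain_bound z y hy
    have h2 := neg_abs_le (l y)
    have h3 := l.norm_coe_le_norm y
    rw [Real.norm_eq_abs] at h3
    linarith
  have hχL : LipschitzWith R χ := lipschitzWith_supTransform hD (fun y hy => hΛR y hy.1) hb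
  have hkint : Integrable k ν := integrable_toReal_of_lintegral_ne_top
    (measurable_conj ψ).aemeasurable h.finite
  have hlint : Integrable (fun y => l y) ν := l.integrable ν
  have hkl : Integrable (fun y => k y + l y) ν := hkint.add hlint
  have hint : Integrable (fun y => k y + l y + χ 0) ν := hkl.add (integrable_const _)
  -- The conjugate of a transform does not exceed the function transformed; subtracting `χ 0`
  -- normalizes the competitor at the cost of adding this constant to its conjugate.
  have hpt : ∀ y ∈ D, conj (fun z => χ z - χ 0) y ≤ ENNReal.ofReal (k y + l y + χ 0) :=
    fun y hy => iSup_le fun z => ENNReal.ofReal_le_ofReal (by linarith [le_supTransform (hb z) hy])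
  have hnn : ∀ y ∈ D, 0 ≤ k y + l y + χ 0 := fun y hy => by
    have := le_supTransform (hb 0) hy
    rw [inner_zero_left] at this
    linarith
  have haeD := ae_mem_conjDomain (ψ := ψ) hΛ h.finite
  have hle : ∫⁻ y, conj (fun z => χ z - χ 0) y ∂ν ≤ ENNReal.ofReal (∫ y, (k y + l y + χ 0) ∂ν) := by
    rw [ofReal_integral_eq_lintegral_ofReal hint (haeD.mono hnn)]
    exact lintegral_mono_ae (haeD.mono hpt)
  have hnonneg : 0 ≤ ∫ y, (k y + l y + χ 0) ∂ν := integral_nonneg_of_ae (haeD.mono hnn)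
  have h1 := h.le (fun z => χ z - χ 0)
    (by simpa using hχL.sub (LipschitzWith.const (χ 0))) (by simp)
    (ne_top_of_le_ne_top ENNReal.ofReal_ne_top hle)
  have h2 := ENNReal.toReal_mono ENNReal.ofReal_ne_top hle
  rw [ENNReal.toReal_ofReal hnonneg, integral_add hkl (integrable_const _),
    integral_add hkint hlint, integral_const, smul_eq_mul] at h2
  have hkeq : ∫ y, k y ∂ν = (∫⁻ y, conj ψ y ∂ν).toReal :=
    integral_toReal (measurable_conj ψ).aemeasurable (ae_lt_top (measurable_conj ψ) h.finite)
  rw [integral_sub (integrable_comp_of_lipschitzWith hχL hG) (integrable_const _), integral_const,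
    smul_eq_mul] at h1
  -- The constant `χ 0` occurs once against `μ` and once against `ν`; equal masses cancel it.
  have hreal : ν.real univ = μ.real univ := by simp [Measure.real, hμν]
  rw [hreal] at h2
  linarith

/-- The transform of `ψ^*` is pointwise at most `ψ`, and optimality with zero perturbation gives the
reverse inequality of integrals. Thus `ψ` agrees with a convex function along `G`, although
convexity was not imposed. -/
lemma IsDualPotential.ae_supTransform_eq (h : IsDualPotential μ ν G R ψ) (hG : Integrable G μ)
    (hμν : ν univ = μ univ) (hΛ : ∀ᵐ y ∂ν, y ∈ Λ) (hΛR : ∀ y ∈ Λ, ‖y‖ ≤ R)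
    (hD : (conjDomain ψ Λ).Nonempty) :
    ∀ᵐ x ∂μ, supTransform (conjDomain ψ Λ) (fun y => (conj ψ y).toReal) (G x) = ψ (G x) := by
  have h1 := h.integral_le hG hμν hΛ hΛR hD 0
  simp only [BoundedContinuousFunction.coe_zero, Pi.zero_apply, add_zero, integral_zero] at h1
  have hχL : LipschitzWith R (supTransform (conjDomain ψ Λ) (fun y => (conj ψ y).toReal)) :=
    lipschitzWith_supTransform hD (fun y hy => hΛR y hy.1) conjDomain_bound
  have hi1 := integrable_comp_of_lipschitzWith hχL hG
  have hi2 := integrable_comp_of_lipschitzWith h.lipschitz hG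
  have hle : ∀ x, supTransform (conjDomain ψ Λ) (fun y => (conj ψ y).toReal) (G x) ≤ ψ (G x) :=
    fun x => supTransform_le hD (conjDomain_bound _)
  have h2 := (integral_eq_zero_iff_of_nonneg (fun x => sub_nonneg.2 (hle x)) (hi2.sub hi1)).1
    (le_antisymm (by rw [integral_sub hi2 hi1]; linarith)
      (integral_nonneg fun x => sub_nonneg.2 (hle x)))
  filter_upwards [h2] with x hx
  exact (sub_eq_zero.1 hx).symm

/-- Near-maximizers in `Λ` are subgradients up to an error tending to `0`, so they converge to the
gradient; membership and the subgradient inequality pass to the limit. -/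
lemma gradient_mem_closure_and_subgradient {x g : E}
    (hD : (conjDomain ψ Λ).Nonempty)
    (hx : supTransform (conjDomain ψ Λ) (fun y => (conj ψ y).toReal) x = ψ x)
    (hg : HasGradientAt ψ g x) :
    g ∈ closure Λ ∧ ∀ x', ⟪x' - x, g⟫ ≤ ψ x' - ψ x := by
  have h1 : ∀ n : ℕ, ∃ y ∈ conjDomain ψ Λ, ψ x - 1 / ((n : ℝ) + 1) < ⟪x, y⟫ - (conj ψ y).toReal :=
    fun n => exists_lt_of_lt_supTransform hD (by rw [hx]; linarith [Nat.one_div_pos_of_nat (α := ℝ) (n := n)])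
  choose y hy hyx using h1
  have hsub : ∀ n x', ⟪x' - x, y n⟫ ≤ ψ x' - ψ x + 1 / ((n : ℝ) + 1) := fun n x' => by
    rw [inner_sub_left]
    linarith [hyx n, conjDomain_bound x' _ (hy n)]
  have hlim : Tendsto y atTop (𝓝 g) := by
    rw [Metric.tendsto_nhds]
    intro ε hε
    obtain ⟨δ, hδ, hd⟩ := norm_sub_gradient_le hg (show 0 < ε / 2 by positivity)
    have ht : Tendsto (fun n : ℕ => 1 / ((n : ℝ) + 1)) atTop (𝓝 0) :=
      tendsto_one_div_add_atTop_nhds_zero_nat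
    filter_upwards [ht.eventually_lt_const (show 0 < ε / 2 * δ by positivity)] with n hn
    rw [dist_eq_norm]
    linarith [hd (y n) _ (hsub n), (div_lt_iff₀ hδ).2 hn]
  refine ⟨mem_closure_of_tendsto hlim (Eventually.of_forall fun n => (hy n).1), fun x' => ?_⟩
  have h2 : Tendsto (fun n : ℕ => ψ x' - ψ x + 1 / ((n : ℝ) + 1)) atTop (𝓝 (ψ x' - ψ x + 0)) :=
    tendsto_const_nhds.add tendsto_one_div_add_atTop_nhds_zero_nat
  rw [add_zero] at h2
  exact le_of_tendsto_of_tendsto' (tendsto_const_nhds.inner hlim) h2 (fun n => hsub n x')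

/-- The gradient of an optimal potential pushes `μ` forward to `ν`. -/
lemma IsDualPotential.map_gradient (h : IsDualPotential μ ν G R ψ) (hG : Integrable G μ)
    (hμν : ν univ = μ univ) (hΛ : ∀ᵐ y ∂ν, y ∈ Λ) (hΛR : ∀ y ∈ Λ, ‖y‖ ≤ R)
    (hD : (conjDomain ψ Λ).Nonempty)
    (hnd : ∀ N : Set E, Measure.addHaar N = 0 → μ (G ⁻¹' N) = 0) :
    μ.map (fun x => ∇ ψ (G x)) = ν := by
  have hm : AEMeasurable (fun x => ∇ ψ (G x)) μ :=
    (measurable_gradient ψ).comp_aemeasurable hG.1.aemeasurable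
  refine ext_of_forall_integral_eq_of_IsFiniteMeasure fun l => ?_
  rw [integral_map hm l.continuous.aestronglyMeasurable]
  have hL : ∀ y, |l y| ≤ ‖l‖ := fun y => l.norm_coe_le_norm y
  let T : ℝ → E → ℝ := fun ε => supTransform (conjDomain ψ Λ) (fun y => (conj ψ y).toReal + ε * l y)
  have hb : ∀ ε z, ∀ y ∈ conjDomain ψ Λ, ⟪z, y⟫ - ((conj ψ y).toReal + ε * l y) ≤ ψ z + |ε| * ‖l‖ := by
    intro ε z y hy
    have h1 := conjDomain_bound z y hy
    have h2 := neg_abs_le (ε * l y)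
    rw [abs_mul] at h2
    nlinarith [mul_le_mul_of_nonneg_left (hL y) (abs_nonneg ε)]
  have hTL : ∀ ε, LipschitzWith R (T ε) := fun ε =>
    lipschitzWith_supTransform hD (fun y hy => hΛR y hy.1) (hb ε)
  have hTle : ∀ ε ε' z, T ε z ≤ T ε' z + ‖l‖ * dist ε ε' := fun ε ε' z => by
    refine supTransform_le_add hD (hb ε' z) fun y _ => ?_
    have h2 := le_abs_self ((ε' - ε) * l y)
    rw [abs_mul, abs_sub_comm] at h2
    rw [Real.dist_eq]
    nlinarith [mul_le_mul_of_nonneg_left (hL y) (abs_nonneg (ε - ε'))]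
  -- `T ε` is `‖l‖`-Lipschitz in `ε`, which dominates the difference quotients under the integral.
  have hder := (hasDerivAt_integral_of_dominated_loc_of_lip (μ := μ) (F := fun ε x => T ε (G x))
    (F' := fun x => -l (∇ ψ (G x))) (bound := fun _ => ‖l‖) (x₀ := (0 : ℝ)) univ_mem
    (Eventually.of_forall fun ε => (hTL ε).continuous.comp_aestronglyMeasurable hG.1)
    (integrable_comp_of_lipschitzWith (hTL 0) hG)
    (l.continuous.neg.comp_aestronglyMeasurable hm.aestronglyMeasurable)
    (Eventually.of_forall fun x => by
      have : LipschitzWith (Real.nnabs ‖l‖) (fun ε => T ε (G x)) :=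
        LipschitzWith.of_le_add_mul _ fun ε ε' => by simpa using hTle ε ε' (G x)
      exact this.lipschitzOnWith)
    (integrable_const _)
    (by
      filter_upwards [h.ae_supTransform_eq hG hμν hΛ hΛR hD, ae_hasGradientAt h.lipschitz hnd]
        with x hx hgx
      exact hasDerivAt_supTransform hD conjDomain_bound hx hgx l.continuous.continuousAt hL)).2
  have hmin : ∀ ε : ℝ, ∫ x, T 0 (G x) ∂μ ≤ ∫ x, T ε (G x) ∂μ + ε * ∫ y, l y ∂ν := by
    intro ε
    have h1 := h.integral_le hG hμν hΛ hΛR hD (ε • l)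
    have h2 : ∫ x, T 0 (G x) ∂μ = ∫ x, ψ (G x) ∂μ := by
      refine integral_congr_ae ?_
      filter_upwards [h.ae_supTransform_eq hG hμν hΛ hΛR hD] with x hx
      simpa [T] using hx
    rw [h2, ← integral_const_mul]
    exact h1
  have hder2 := hder.add ((hasDerivAt_id (0 : ℝ)).mul_const (∫ y, l y ∂ν))
  -- Minimality at `ε = 0` makes the derivative `-∫ l(∇ψ(G)) dμ + ∫ l dν` vanish, for every test
  -- function `l`.
  have hloc : IsLocalMin (fun ε : ℝ => ∫ x, T ε (G x) ∂μ + id ε * ∫ y, l y ∂ν) 0 :=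
    Eventually.of_forall fun ε => by simpa using hmin ε
  have h0 := hloc.hasDerivAt_eq_zero hder2
  rw [integral_neg, one_mul] at h0
  linarith

/-- Weak duality: a map pushing `μ` to `ν` has `∫ ⟪G, v⟫ ≤ ∫ ψ(G) + ∫ ψ^*`, with equality only
for `v = ∇ψ(G)`. -/
lemma integral_inner_le_and_eq (hψ : LipschitzWith R ψ) (hfin : ∫⁻ y, conj ψ y ∂ν ≠ ⊤)
    (hG : Integrable G μ)
    (hnd : ∀ N : Set E, Measure.addHaar N = 0 → μ (G ⁻¹' N) = 0) {v : α → E}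
    (hv : AEMeasurable v μ) (hmap : μ.map v = ν) (hint : Integrable (fun x => ⟪G x, v x⟫) μ) :
    ∫ x, ⟪G x, v x⟫ ∂μ ≤ ∫ x, ψ (G x) ∂μ + (∫⁻ y, conj ψ y ∂ν).toReal ∧
    (∫ x, ⟪G x, v x⟫ ∂μ = ∫ x, ψ (G x) ∂μ + (∫⁻ y, conj ψ y ∂ν).toReal →
      v =ᵐ[μ] fun x => ∇ ψ (G x)) := by
  have hlin : ∫⁻ x, conj ψ (v x) ∂μ = ∫⁻ y, conj ψ y ∂ν := by
    rw [← hmap, lintegral_map' (measurable_conj ψ).aemeasurable hv]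
  have hcm : AEMeasurable (fun x => conj ψ (v x)) μ := (measurable_conj ψ).comp_aemeasurable hv
  have hfin' : ∫⁻ x, conj ψ (v x) ∂μ ≠ ⊤ := hlin ▸ hfin
  have hki : Integrable (fun x => (conj ψ (v x)).toReal) μ :=
    integrable_toReal_of_lintegral_ne_top hcm hfin'
  have hae : ∀ᵐ x ∂μ, conj ψ (v x) < ⊤ := ae_lt_top' hcm hfin'
  have hψi := integrable_comp_of_lipschitzWith hψ hG
  have hkeq : ∫ x, (conj ψ (v x)).toReal ∂μ = (∫⁻ y, conj ψ y ∂ν).toReal := by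
    rw [integral_toReal hcm hae, hlin]
  have hle : ∀ᵐ x ∂μ, 0 ≤ ψ (G x) + (conj ψ (v x)).toReal - ⟪G x, v x⟫ := by
    filter_upwards [hae] with x hx
    linarith [inner_sub_le_toReal_conj hx.ne (G x)]
  have hsum : Integrable (fun x => ψ (G x) + (conj ψ (v x)).toReal) μ := hψi.add hki
  have hI : ∫ x, (ψ (G x) + (conj ψ (v x)).toReal - ⟪G x, v x⟫) ∂μ
      = ∫ x, ψ (G x) ∂μ + (∫⁻ y, conj ψ y ∂ν).toReal - ∫ x, ⟪G x, v x⟫ ∂μ := by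
    rw [integral_sub hsum hint, integral_add hψi hki, hkeq]
  refine ⟨by linarith [integral_nonneg_of_ae hle], fun heq => ?_⟩
  -- Equality of the integrals makes the nonnegative Fenchel gap vanish almost everywhere, so `v x`
  -- is a subgradient at a point of differentiability.
  have h0 := (integral_eq_zero_iff_of_nonneg_ae hle (hsum.sub hint)).1 (by rw [hI]; linarith)
  filter_upwards [h0, hae, ae_hasGradientAt hψ hnd] with x hx hfx hgx
  refine eq_gradient_of_subgradient hgx fun x' => ?_
  have h1 := inner_sub_le_toReal_conj hfx.ne x'
  simp only [Pi.zero_apply] at hx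
  rw [inner_sub_left]
  linarith

/-- Pointwise Fenchel equality at the gradient; with weak duality it makes `∇ψ(G)` optimal. -/
lemma IsDualPotential.integral_inner_gradient (h : IsDualPotential μ ν G R ψ) (hG : Integrable G μ)
    (hμν : ν univ = μ univ) (hΛ : ∀ᵐ y ∂ν, y ∈ Λ) (hΛR : ∀ y ∈ Λ, ‖y‖ ≤ R)
    (hD : (conjDomain ψ Λ).Nonempty)
    (hnd : ∀ N : Set E, Measure.addHaar N = 0 → μ (G ⁻¹' N) = 0) :
    ∫ x, ⟪G x, ∇ ψ (G x)⟫ ∂μ = ∫ x, ψ (G x) ∂μ + (∫⁻ y, conj ψ y ∂ν).toReal := by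
  have hm : AEMeasurable (fun x => ∇ ψ (G x)) μ :=
    (measurable_gradient ψ).comp_aemeasurable hG.1.aemeasurable
  have hmap := h.map_gradient hG hμν hΛ hΛR hD hnd
  have hlin : ∫⁻ x, conj ψ (∇ ψ (G x)) ∂μ = ∫⁻ y, conj ψ y ∂ν := by
    rw [← lintegral_map' (measurable_conj ψ).aemeasurable hm, hmap]
  have hcm : AEMeasurable (fun x => conj ψ (∇ ψ (G x))) μ :=
    (measurable_conj ψ).comp_aemeasurable hm
  have hfin' : ∫⁻ x, conj ψ (∇ ψ (G x)) ∂μ ≠ ⊤ := hlin ▸ h.finite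
  have hki : Integrable (fun x => (conj ψ (∇ ψ (G x))).toReal) μ :=
    integrable_toReal_of_lintegral_ne_top hcm hfin'
  rw [← hlin, ← integral_toReal hcm (ae_lt_top' hcm hfin'),
    ← integral_add (integrable_comp_of_lipschitzWith h.lipschitz hG) hki]
  refine integral_congr_ae ?_
  filter_upwards [h.ae_supTransform_eq hG hμν hΛ hΛR hD, ae_hasGradientAt h.lipschitz hnd]
    with x hx hgx
  have hs := (gradient_mem_closure_and_subgradient hD hx hgx).2
  -- Testing at `0`, where `ψ` vanishes, makes the conjugate value nonnegative, so the truncation in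
  -- `conj` is harmless.
  have h0 := hs 0
  rw [h.map_zero, zero_sub, inner_neg_left] at h0
  rw [conj_eq_of_subgradient hs, ENNReal.toReal_ofReal (by linarith)]
  ring

end DualPotential

/-! ### Minimizing jointly over potentials and fields -/

section JointMinimum

variable {E : Type*} [NormedAddCommGroup E] [InnerProductSpace ℝ E] [FiniteDimensional ℝ E]
  [MeasurableSpace E] [BorelSpace E] {α : Type*} [MeasurableSpace α] {μ : Measure α}
  [IsFiniteMeasure μ] {ν : Measure E} [IsFiniteMeasure ν] {R : ℝ≥0} {ψ : E → ℝ}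
  {W : Type*} [NormedAddCommGroup W] [NormedSpace ℝ W] [FiniteDimensional ℝ W]
  {M : Type*} [NormedAddCommGroup M] [NormedSpace ℝ M] [MeasurableSpace M] [BorelSpace M]
  {F : α → E} {D : α → W →L[ℝ] E} {Φ : α → W →L[ℝ] M} {e : M → ℝ≥0∞}

/-- Injectivity makes `c ↦ ∫ ‖Φ c‖` a norm on a finite-dimensional space, hence comparable to the
given one. -/
lemma exists_mul_norm_le_integral (hΦ : Integrable Φ μ)
    (hinj : ∀ c, (∀ᵐ x ∂μ, Φ x c = 0) → c = 0) :
    ∃ δ > 0, ∀ c, δ * ‖c‖ ≤ ∫ x, ‖Φ x c‖ ∂μ := by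
  have hi : ∀ c, Integrable (fun x => Φ x c) μ := fun c => hΦ.apply_continuousLinearMap c
  let T : W →ₗ[ℝ] Lp M 1 μ :=
    { toFun := fun c => (hi c).toL1 _
      map_add' := fun c c' => by
        rw [← Integrable.toL1_add]
        exact (Integrable.toL1_eq_toL1_iff _ _ _ _).2 (Eventually.of_forall fun x => by simp)
      map_smul' := fun t c => by
        rw [RingHom.id_apply, ← Integrable.toL1_smul]
        exact (Integrable.toL1_eq_toL1_iff _ _ _ _).2 (Eventually.of_forall fun x => by simp) }
  have hker : LinearMap.ker T = ⊥ := by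
    refine LinearMap.ker_eq_bot'.2 fun c hc => hinj c ?_
    have h1 := (hi c).coeFn_toL1
    have h2 : (hi c).toL1 _ = 0 := hc
    rw [h2] at h1
    filter_upwards [h1, Lp.coeFn_zero M 1 μ] with x hx hx0
    rw [← hx, hx0, Pi.zero_apply]
  obtain ⟨K, hK, hT⟩ := T.exists_antilipschitzWith hker
  refine ⟨(K : ℝ)⁻¹, by positivity, fun c => ?_⟩
  have h1 := hT.le_mul_dist c 0
  rw [map_zero, dist_zero_right, dist_zero_right] at h1
  have h2 : ‖T c‖ = ∫ x, ‖Φ x c‖ ∂μ := L1.norm_of_fun_eq_integral_norm (hi c)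
  rw [h2] at h1
  rwa [inv_mul_le_iff₀ (by exact_mod_cast hK)]

/-- Superlinear growth. -/
def IsSuperlinear (e : M → ℝ≥0∞) : Prop :=
  ∀ A : ℝ, 0 ≤ A → ∃ C : ℝ, 0 ≤ C ∧ ∀ η, ENNReal.ofReal (A * ‖η‖) ≤ e η + ENNReal.ofReal C

lemma IsSuperlinear.mul_norm_le (he : IsSuperlinear e) (hΦ : Integrable Φ μ)
    (hinj : ∀ c, (∀ᵐ x ∂μ, Φ x c = 0) → c = 0) {A : ℝ} (hA : 0 ≤ A) :
    ∃ C : ℝ, ∀ c, ∫⁻ x, e (Φ x c) ∂μ ≠ ⊤ → A * ‖c‖ ≤ (∫⁻ x, e (Φ x c) ∂μ).toReal + C := by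
  obtain ⟨δ, hδ, hd⟩ := exists_mul_norm_le_integral hΦ hinj
  obtain ⟨C, hC, hCe⟩ := he (A / δ) (by positivity)
  refine ⟨C * μ.real univ, fun c hc => ?_⟩
  have h1 : ENNReal.ofReal (∫ x, A / δ * ‖Φ x c‖ ∂μ)
      ≤ ∫⁻ x, e (Φ x c) ∂μ + ENNReal.ofReal C * μ univ := by
    rw [ofReal_integral_eq_lintegral_ofReal ((hΦ.apply_continuousLinearMap c).norm.const_mul _)
      (Eventually.of_forall fun x => by positivity), ← lintegral_const,
      ← lintegral_add_right _ measurable_const]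
    exact lintegral_mono fun x => hCe _
  have hfin : ENNReal.ofReal C * μ univ ≠ ⊤ :=
    ENNReal.mul_ne_top ENNReal.ofReal_ne_top (measure_ne_top _ _)
  rw [ENNReal.ofReal_le_iff_le_toReal (ENNReal.add_ne_top.2 ⟨hc, hfin⟩),
    ENNReal.toReal_add hc hfin, ENNReal.toReal_mul, ENNReal.toReal_ofReal hC,
    integral_const_mul] at h1
  refine le_trans ?_ h1
  calc A * ‖c‖ = A / δ * (δ * ‖c‖) := by field_simp
    _ ≤ _ := mul_le_mul_of_nonneg_left (hd c) (by positivity)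

/-- The part of the dual functional with values in `[0, ∞]`. -/
noncomputable def conjPart (μ : Measure α) (ν : Measure E) (Φ : α → W →L[ℝ] M) (e : M → ℝ≥0∞)
    (ψ : E → ℝ) (c : W) : ℝ≥0∞ :=
  ∫⁻ y, conj ψ y ∂ν + ∫⁻ x, e (Φ x c) ∂μ

/-- The dual functional. -/
noncomputable def dualEnergy (μ : Measure α) (ν : Measure E) (F : α → E) (D : α → W →L[ℝ] E)
    (Φ : α → W →L[ℝ] M) (e : M → ℝ≥0∞) (ψ : E → ℝ) (c : W) : ℝ :=
  ∫ x, ψ (F x + D x c) ∂μ + (conjPart μ ν Φ e ψ c).toReal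

/-- `(ψ, c)` minimizes the dual functional. -/
structure IsDualMinimizer (μ : Measure α) (ν : Measure E) (F : α → E) (D : α → W →L[ℝ] E)
    (Φ : α → W →L[ℝ] M) (e : M → ℝ≥0∞) (R : ℝ≥0) (ψ : E → ℝ) (c : W) : Prop where
  lipschitz : LipschitzWith R ψ
  map_zero : ψ 0 = 0
  finite : conjPart μ ν Φ e ψ c ≠ ⊤
  le : ∀ (χ : E → ℝ) (b : W), LipschitzWith R χ → χ 0 = 0 → conjPart μ ν Φ e χ b ≠ ⊤ →
    dualEnergy μ ν F D Φ e ψ c ≤ dualEnergy μ ν F D Φ e χ b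

lemma abs_le_of_lipschitzWith (hψ : LipschitzWith R ψ) (h0 : ψ 0 = 0) (z : E) :
    |ψ z| ≤ R * ‖z‖ := by
  simpa [Real.dist_eq, h0] using hψ.dist_le_mul z 0

lemma abs_comp_le (hψ : LipschitzWith R ψ) (h0 : ψ 0 = 0) (x : α) {c : W} {B : ℝ} (hc : ‖c‖ ≤ B) :
    |ψ (F x + D x c)| ≤ R * (‖F x‖ + ‖D x‖ * B) := by
  refine (abs_le_of_lipschitzWith hψ h0 _).trans (mul_le_mul_of_nonneg_left ?_ R.2)
  refine (norm_add_le _ _).trans (add_le_add_right (((D x).le_opNorm c).trans ?_) _)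
  exact mul_le_mul_of_nonneg_left hc (norm_nonneg _)

lemma integrable_add_apply (hF : Integrable F μ) (hD : Integrable D μ) (c : W) :
    Integrable (fun x => F x + D x c) μ := hF.add (hD.apply_continuousLinearMap c)

lemma norm_le_dualEnergy_add (hF : Integrable F μ) (hD : Integrable D μ) (hΦ : Integrable Φ μ)
    (hinj : ∀ c, (∀ᵐ x ∂μ, Φ x c = 0) → c = 0) (he : IsSuperlinear e) (ν : Measure E) (R : ℝ≥0) :
    ∃ K : ℝ, ∀ (ψ : E → ℝ) (c : W), LipschitzWith R ψ → ψ 0 = 0 → conjPart μ ν Φ e ψ c ≠ ⊤ →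
      ‖c‖ ≤ dualEnergy μ ν F D Φ e ψ c + K := by
  -- The Lipschitz term can decrease at rate at most `R * ∫ ‖D‖` in `‖c‖`; the extra `1` leaves
  -- `‖c‖` itself under control.
  obtain ⟨C, hC⟩ := he.mul_norm_le hΦ hinj (A := R * ∫ x, ‖D x‖ ∂μ + 1)
    (by have : 0 ≤ ∫ x, ‖D x‖ ∂μ := integral_nonneg fun x => norm_nonneg _
        positivity)
  refine ⟨R * ∫ x, ‖F x‖ ∂μ + C, fun ψ c hψ h0 hfin => ?_⟩
  obtain ⟨hf1, hf2⟩ := ENNReal.add_ne_top.1 hfin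
  have h1 := hC c hf2
  have h2 : |∫ x, ψ (F x + D x c) ∂μ| ≤ R * (∫ x, ‖F x‖ ∂μ + (∫ x, ‖D x‖ ∂μ) * ‖c‖) := by
    rw [← integral_mul_const, ← integral_add hF.norm (hD.norm.mul_const _), ← integral_const_mul]
    have hg : Integrable (fun x => R * (‖F x‖ + ‖D x‖ * ‖c‖)) μ :=
      (hF.norm.add (hD.norm.mul_const _)).const_mul _
    refine norm_integral_le_of_norm_le (f := fun x => ψ (F x + D x c)) hg (Eventually.of_forall fun x => ?_)
    exact abs_comp_le hψ h0 x le_rfl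
  have h3 : (conjPart μ ν Φ e ψ c).toReal
      = (∫⁻ y, conj ψ y ∂ν).toReal + (∫⁻ x, e (Φ x c) ∂μ).toReal := ENNReal.toReal_add hf1 hf2
  have h4 : 0 ≤ (∫⁻ y, conj ψ y ∂ν).toReal := ENNReal.toReal_nonneg
  rw [dualEnergy, h3]
  nlinarith [(abs_le.1 h2).1]

lemma tendsto_integral_comp (hF : Integrable F μ) (hD : Integrable D μ) {ψs : ℕ → E → ℝ}
    {cs : ℕ → W} {c : W} (hL : ∀ n, LipschitzWith R (ψs n)) (h0 : ∀ n, ψs n 0 = 0)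
    (hψs : ∀ x, Tendsto (fun n => ψs n x) atTop (𝓝 (ψ x))) (hcs : Tendsto cs atTop (𝓝 c))
    {B : ℝ} (hB : ∀ n, ‖cs n‖ ≤ B) :
    Tendsto (fun n => ∫ x, ψs n (F x + D x (cs n)) ∂μ) atTop (𝓝 (∫ x, ψ (F x + D x c) ∂μ)) := by
  refine tendsto_integral_of_dominated_convergence (fun x => R * (‖F x‖ + ‖D x‖ * B))
    (fun n => (hL n).continuous.comp_aestronglyMeasurable (integrable_add_apply hF hD _).1)
    ((hF.norm.add (hD.norm.mul_const _)).const_mul _)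
    (fun n => Eventually.of_forall fun x => abs_comp_le (hL n) (h0 n) x (hB n))
    (Eventually.of_forall fun x => ?_)
  have hz : Tendsto (fun n => F x + D x (cs n)) atTop (𝓝 (F x + D x c)) :=
    tendsto_const_nhds.add (((D x).continuous.tendsto c).comp hcs)
  rw [tendsto_iff_dist_tendsto_zero]
  refine squeeze_zero (fun n => dist_nonneg)
    (g := fun n => R * dist (F x + D x (cs n)) (F x + D x c)
      + dist (ψs n (F x + D x c)) (ψ (F x + D x c)))
    (fun n => (dist_triangle _ (ψs n (F x + D x c)) _).trans
      (add_le_add_left ((hL n).dist_le_mul _ _) _)) ?_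
  simpa using ((tendsto_iff_dist_tendsto_zero.1 hz).const_mul (R : ℝ)).add
    (tendsto_iff_dist_tendsto_zero.1 (hψs (F x + D x c)))

lemma ennreal_liminf_add_le (u v : ℕ → ℝ≥0∞) :
    liminf u atTop + liminf v atTop ≤ liminf (fun n => u n + v n) atTop := by
  have hmono : ∀ w : ℕ → ℝ≥0∞, Monotone fun n => ⨅ i ≥ n, w i := fun w m n hmn =>
    le_iInf₂ fun i hi => iInf₂_le i (hmn.trans hi)
  simp only [liminf_eq_iSup_iInf_of_nat]
  rw [ENNReal.iSup_add_iSup_of_monotone (hmono u) (hmono v)]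
  exact iSup_mono fun n => le_iInf₂ fun i hi => add_le_add (iInf₂_le i hi) (iInf₂_le i hi)

lemma conjPart_le_liminf (hΦ : Integrable Φ μ) (hlsc : LowerSemicontinuous e) {ψs : ℕ → E → ℝ}
    {cs : ℕ → W} {c : W} (hψs : ∀ x, Tendsto (fun n => ψs n x) atTop (𝓝 (ψ x)))
    (hcs : Tendsto cs atTop (𝓝 c)) :
    conjPart μ ν Φ e ψ c ≤ liminf (fun n => conjPart μ ν Φ e (ψs n) (cs n)) atTop := by
  have h1 : ∫⁻ y, conj ψ y ∂ν ≤ liminf (fun n => ∫⁻ y, conj (ψs n) y ∂ν) atTop :=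
    (lintegral_mono fun y => conj_le_liminf hψs y).trans
      (lintegral_liminf_le fun n => measurable_conj (ψs n))
  have h2 : ∫⁻ x, e (Φ x c) ∂μ ≤ liminf (fun n => ∫⁻ x, e (Φ x (cs n)) ∂μ) atTop := by
    refine (lintegral_mono fun x => ?_).trans (lintegral_liminf_le' fun n =>
      hlsc.measurable.comp_aemeasurable (hΦ.apply_continuousLinearMap (cs n)).1.aemeasurable)
    have ht : Tendsto (fun n => Φ x (cs n)) atTop (𝓝 (Φ x c)) :=
      ((Φ x).continuous.tendsto c).comp hcs
    exact (lowerSemicontinuousAt_iff_le_liminf.1 (hlsc (Φ x c))).trans ht.liminf_le_liminf_comp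
  exact (add_le_add h1 h2).trans (ennreal_liminf_add_le _ _)

/-- Supplies an admissible potential of finite energy, as `ν` lives on the ball of radius `R`. -/
lemma conj_mul_norm_eq_zero {y : E} (hy : ‖y‖ ≤ R) : conj (fun x => R * ‖x‖) y = 0 := by
  refine le_antisymm (iSup_le fun x => ?_) zero_le
  rw [ENNReal.ofReal_of_nonpos]
  have := (real_inner_le_norm x y).trans (mul_le_mul_of_nonneg_left hy (norm_nonneg x))
  linarith

/-- Direct method: coercivity in `c`, pointwise compactness of the potentials, and lower
semicontinuity of the `[0, ∞]`-valued part. -/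
theorem exists_isDualMinimizer (hF : Integrable F μ) (hD : Integrable D μ) (hΦ : Integrable Φ μ)
    (hinj : ∀ c, (∀ᵐ x ∂μ, Φ x c = 0) → c = 0) (he : IsSuperlinear e)
    (hlsc : LowerSemicontinuous e) (hν : ∀ᵐ y ∂ν, ‖y‖ ≤ R)
    (hfin : ∃ c, ∫⁻ x, e (Φ x c) ∂μ ≠ ⊤) :
    ∃ ψ c, IsDualMinimizer μ ν F D Φ e R ψ c := by
  obtain ⟨K, hK⟩ := norm_le_dualEnergy_add hF hD hΦ hinj he ν R
  let A : Set ℝ := {t | ∃ (ψ : E → ℝ) (c : W), LipschitzWith R ψ ∧ ψ 0 = 0 ∧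
    conjPart μ ν Φ e ψ c ≠ ⊤ ∧ dualEnergy μ ν F D Φ e ψ c = t}
  have hA : A.Nonempty := by
    obtain ⟨c, hc⟩ := hfin
    refine ⟨_, fun x => R * ‖x‖, c, ?_, by simp, ?_, rfl⟩
    · exact LipschitzWith.of_dist_le_mul fun x y => by
        rw [Real.dist_eq, ← mul_sub, abs_mul, abs_of_nonneg R.coe_nonneg, dist_eq_norm]
        exact mul_le_mul_of_nonneg_left (abs_norm_sub_norm_le x y) R.2
    · have : ∫⁻ y, conj (fun x : E => R * ‖x‖) y ∂ν = 0 := by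
        rw [lintegral_congr_ae (hν.mono fun y hy => conj_mul_norm_eq_zero hy), lintegral_zero]
      rw [conjPart, this, zero_add]
      exact hc
  have hbdd : BddBelow A := by
    refine ⟨-K, ?_⟩
    rintro _ ⟨ψ, c, h1, h2, h3, rfl⟩
    linarith [hK ψ c h1 h2 h3, norm_nonneg c]
  obtain ⟨u, hu, hulim, huA⟩ := exists_seq_tendsto_sInf hA hbdd
  choose ψs cs hL h0 hfs heq using huA
  have hcb : ∀ n, ‖cs n‖ ≤ u 0 + K := fun n => by
    linarith [hK _ _ (hL n) (h0 n) (hfs n), heq n, hu (Nat.zero_le n)]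
  obtain ⟨c, -, s, hs, hsc⟩ := tendsto_subseq_of_bounded
    (Metric.isBounded_closedBall (x := (0 : W)) (r := u 0 + K))
    (x := cs) (fun n => mem_closedBall_zero_iff.2 (hcb n))
  obtain ⟨ψ, hψL, hψ0, s', hs', hψ⟩ := exists_subseq_tendsto_of_lipschitz (0 : E)
    (fun n => hL (s n)) (fun n => h0 (s n))
  have hs2 : Tendsto (fun n => s (s' n)) atTop atTop := hs.tendsto_atTop.comp hs'.tendsto_atTop
  have hc' : Tendsto (fun n => cs (s (s' n))) atTop (𝓝 c) := hsc.comp hs'.tendsto_atTop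
  have hI := tendsto_integral_comp hF hD (fun n => hL (s (s' n))) (fun n => h0 (s (s' n))) hψ hc'
    (fun n => hcb (s (s' n)))
  -- The energies and the integral term both converge, so the remaining part has a limit, to which
  -- lower semicontinuity applies.
  have hB : Tendsto (fun n => (conjPart μ ν Φ e (ψs (s (s' n))) (cs (s (s' n)))).toReal) atTop
      (𝓝 (sInf A - ∫ x, ψ (F x + D x c) ∂μ)) := by
    refine ((hulim.comp hs2).sub hI).congr fun n => ?_
    simp only [Function.comp_apply, ← heq, dualEnergy]
    ring
  have hnn : 0 ≤ sInf A - ∫ x, ψ (F x + D x c) ∂μ :=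
    ge_of_tendsto hB (Eventually.of_forall fun n => ENNReal.toReal_nonneg)
  have hB' : Tendsto (fun n => conjPart μ ν Φ e (ψs (s (s' n))) (cs (s (s' n)))) atTop
      (𝓝 (ENNReal.ofReal (sInf A - ∫ x, ψ (F x + D x c) ∂μ))) := by
    refine ((ENNReal.continuous_ofReal.tendsto _).comp hB).congr fun n => ?_
    exact ENNReal.ofReal_toReal (hfs _)
  have hle := conjPart_le_liminf (μ := μ) (ν := ν) hΦ hlsc hψ hc'
  rw [hB'.liminf_eq] at hle
  refine ⟨ψ, c, hψL, hψ0, ne_top_of_le_ne_top ENNReal.ofReal_ne_top hle, fun χ b h1 h2 h3 => ?_⟩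
  have hle' := ENNReal.toReal_mono ENNReal.ofReal_ne_top hle
  rw [ENNReal.toReal_ofReal hnn] at hle'
  have : sInf A ≤ dualEnergy μ ν F D Φ e χ b := csInf_le hbdd ⟨χ, b, h1, h2, h3, rfl⟩
  rw [dualEnergy]
  linarith

variable {c : W}

lemma IsDualMinimizer.isDualPotential (h : IsDualMinimizer μ ν F D Φ e R ψ c) :
    IsDualPotential μ ν (fun x => F x + D x c) R ψ := by
  obtain ⟨h1, h2⟩ := ENNReal.add_ne_top.1 h.finite
  refine ⟨h.lipschitz, h.map_zero, h1, fun χ hχ hχ0 hfin => ?_⟩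
  have h3 := h.le χ c hχ hχ0 (ENNReal.add_ne_top.2 ⟨hfin, h2⟩)
  simp only [dualEnergy, conjPart] at h3
  rw [ENNReal.toReal_add h1 h2, ENNReal.toReal_add hfin h2] at h3
  linarith

/-- First variation of the dual functional in `c`. -/
lemma IsDualMinimizer.sub_le (h : IsDualMinimizer μ ν F D Φ e R ψ c) (hF : Integrable F μ)
    (hD : Integrable D μ) (hΦ : Integrable Φ μ) (hlsc : LowerSemicontinuous e)
    (hconv : ∀ (a b : M) (t : ℝ), 0 ≤ t → t ≤ 1 →
      e ((1 - t) • a + t • b) ≤ ENNReal.ofReal (1 - t) * e a + ENNReal.ofReal t * e b)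
    (hnd : ∀ N : Set E, Measure.addHaar N = 0 → μ ((fun x => F x + D x c) ⁻¹' N) = 0)
    {b : W} (hb : ∫⁻ x, e (Φ x b) ∂μ ≠ ⊤) :
    (∫⁻ x, e (Φ x c) ∂μ).toReal - (∫⁻ x, e (Φ x b) ∂μ).toReal
      ≤ ∫ x, ⟪∇ ψ (F x + D x c), D x (b - c)⟫ ∂μ := by
  obtain ⟨h1, h2⟩ := ENNReal.add_ne_top.1 h.finite
  have hG := integrable_add_apply hF hD c
  have hδ : Integrable (fun x => D x (b - c)) μ := hD.apply_continuousLinearMap _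
  have hm : AEMeasurable (fun x => ∇ ψ (F x + D x c)) μ :=
    (measurable_gradient ψ).comp_aemeasurable hG.1.aemeasurable
  have hder := (hasDerivAt_integral_of_dominated_loc_of_lip (μ := μ)
    (F := fun t x => ψ (F x + D x c + t • D x (b - c)))
    (F' := fun x => ⟪∇ ψ (F x + D x c), D x (b - c)⟫) (bound := fun x => R * ‖D x (b - c)‖)
    (x₀ := (0 : ℝ)) univ_mem
    (Eventually.of_forall fun t =>
      h.lipschitz.continuous.comp_aestronglyMeasurable (hG.1.add (hδ.1.const_smul t)))
    (by simpa using integrable_comp_of_lipschitzWith h.lipschitz hG)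
    (hm.aestronglyMeasurable.inner hδ.1)
    (Eventually.of_forall fun x => by
      refine (LipschitzWith.of_dist_le_mul fun t t' => ?_).lipschitzOnWith
      refine (h.lipschitz.dist_le_mul _ _).trans (le_of_eq ?_)
      rw [dist_add_left, dist_eq_norm, ← sub_smul, norm_smul, Real.coe_nnabs,
        abs_of_nonneg (by positivity), Real.dist_eq, Real.norm_eq_abs]
      ring)
    (hδ.norm.const_mul _)
    (by
      filter_upwards [ae_hasGradientAt h.lipschitz hnd] with x hx
      have hline : HasDerivAt (fun t : ℝ => F x + D x c + t • D x (b - c)) (D x (b - c)) 0 := by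
        simpa using ((hasDerivAt_id (0 : ℝ)).smul_const (D x (b - c))).const_add (F x + D x c)
      have hx' : HasFDerivAt ψ (InnerProductSpace.toDual ℝ E (∇ ψ (F x + D x c)))
          (F x + D x c + (0 : ℝ) • D x (b - c)) := by
        simpa using hx.hasFDerivAt
      simpa [Function.comp_def] using hx'.comp_hasDerivAt (0 : ℝ) hline)).2
  set I : ℝ → ℝ := fun t => ∫ x, ψ (F x + D x c + t • D x (b - c)) ∂μ with hIdef
  -- `e` need not be differentiable: convexity bounds the slopes for `t ∈ (0, 1]` from below by a
  -- quantity independent of `t`, and then `t → 0+`.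
  have hslope := hder.hasDerivWithinAt (s := Ioi 0)
  rw [hasDerivWithinAt_iff_tendsto_slope' (by simp)] at hslope
  refine ge_of_tendsto hslope ?_
  filter_upwards [Ioc_mem_nhdsGT (zero_lt_one' ℝ)] with t ht
  have hcomb : c + t • (b - c) = (1 - t) • c + t • b := by
    rw [smul_sub, sub_smul, one_smul]; abel
  have hle : ∫⁻ x, e (Φ x (c + t • (b - c))) ∂μ
      ≤ ENNReal.ofReal (1 - t) * ∫⁻ x, e (Φ x c) ∂μ + ENNReal.ofReal t * ∫⁻ x, e (Φ x b) ∂μ := by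
    have hmeas : AEMeasurable (fun x => e (Φ x b)) μ :=
      hlsc.measurable.comp_aemeasurable (hΦ.apply_continuousLinearMap b).1.aemeasurable
    rw [← lintegral_const_mul' _ _ ENNReal.ofReal_ne_top,
      ← lintegral_const_mul' _ _ ENNReal.ofReal_ne_top,
      ← lintegral_add_right' _ (hmeas.const_mul _)]
    refine lintegral_mono fun x => ?_
    rw [hcomb, map_add, map_smul, map_smul]
    exact hconv _ _ t ht.1.le ht.2
  have hf1 := ENNReal.mul_ne_top (ENNReal.ofReal_ne_top (r := 1 - t)) h2
  have hf2 := ENNReal.mul_ne_top (ENNReal.ofReal_ne_top (r := t)) hb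
  have hrfin := ENNReal.add_ne_top.2 ⟨hf1, hf2⟩
  have hlfin := ne_top_of_le_ne_top hrfin hle
  have hle' := ENNReal.toReal_mono hrfin hle
  rw [ENNReal.toReal_add hf1 hf2, ENNReal.toReal_mul, ENNReal.toReal_mul,
    ENNReal.toReal_ofReal ht.1.le, ENNReal.toReal_ofReal (by linarith [ht.2])] at hle'
  have hopt := h.le ψ (c + t • (b - c)) h.lipschitz h.map_zero (ENNReal.add_ne_top.2 ⟨h1, hlfin⟩)
  simp only [dualEnergy, conjPart] at hopt
  rw [ENNReal.toReal_add h1 h2, ENNReal.toReal_add h1 hlfin] at hopt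
  have hI0 : I 0 = ∫ x, ψ (F x + D x c) ∂μ := by simp [hIdef]
  have hIt : I t = ∫ x, ψ (F x + D x (c + t • (b - c))) ∂μ := by
    simp only [hIdef, map_add, map_smul, add_assoc]
  rw [slope_def_field, sub_zero, le_div_iff₀ ht.1, hI0, hIt]
  linarith

/-- A dual minimizer yields a map `u` pushing `μ` to `ν` that satisfies the optimality condition in
`c` and is the unique maximizer of `∫ ⟪F + D c, v⟫` among such maps. -/
theorem exists_optimal_map {Λ : Set E} (hF : Integrable F μ) (hD : Integrable D μ)
    (hΦ : Integrable Φ μ) (hinj : ∀ c, (∀ᵐ x ∂μ, Φ x c = 0) → c = 0) (he : IsSuperlinear e)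
    (hlsc : LowerSemicontinuous e)
    (hconv : ∀ (a b : M) (t : ℝ), 0 ≤ t → t ≤ 1 →
      e ((1 - t) • a + t • b) ≤ ENNReal.ofReal (1 - t) * e a + ENNReal.ofReal t * e b)
    (hfin : ∃ c, ∫⁻ x, e (Φ x c) ∂μ ≠ ⊤) (hμν : ν univ = μ univ) (hν0 : ν ≠ 0)
    (hΛ : ∀ᵐ y ∂ν, y ∈ Λ) (hΛR : ∀ y ∈ Λ, ‖y‖ ≤ R) (h0Λ : (0 : E) ∈ closure Λ)
    (hnd : ∀ (c : W) (N : Set E), Measure.addHaar N = 0 → μ ((fun x => F x + D x c) ⁻¹' N) = 0) :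
    ∃ (c : W) (u : α → E), ∫⁻ x, e (Φ x c) ∂μ ≠ ⊤ ∧ AEMeasurable u μ ∧ (∀ x, u x ∈ closure Λ) ∧
      μ.map u = ν ∧
      (∀ b, ∫⁻ x, e (Φ x b) ∂μ ≠ ⊤ →
        (∫⁻ x, e (Φ x c) ∂μ).toReal - (∫⁻ x, e (Φ x b) ∂μ).toReal ≤ ∫ x, ⟪u x, D x (b - c)⟫ ∂μ) ∧
      ∀ v : α → E, AEMeasurable v μ → Integrable (fun x => ⟪F x + D x c, v x⟫) μ → μ.map v = ν →
        ∫ x, ⟪F x + D x c, v x⟫ ∂μ ≤ ∫ x, ⟪F x + D x c, u x⟫ ∂μ ∧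
        (∫ x, ⟪F x + D x c, v x⟫ ∂μ = ∫ x, ⟪F x + D x c, u x⟫ ∂μ → v =ᵐ[μ] u) := by
  classical
  obtain ⟨ψ, c, hmin⟩ := exists_isDualMinimizer (μ := μ) (ν := ν) (R := R) hF hD hΦ hinj he hlsc
    (hΛ.mono hΛR) hfin
  have hpot := hmin.isDualPotential
  set G : α → E := fun x => F x + D x c with hG
  have hGi : Integrable G μ := integrable_add_apply hF hD c
  have : NeBot (ae ν) := ae_neBot.2 hν0
  have hdom : (conjDomain ψ Λ).Nonempty := (ae_mem_conjDomain hΛ hpot.finite).exists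
  have hgm : AEMeasurable (fun x => ∇ ψ (G x)) μ :=
    (measurable_gradient ψ).comp_aemeasurable hGi.1.aemeasurable
  have hgΛ : ∀ᵐ x ∂μ, ∇ ψ (G x) ∈ closure Λ := by
    filter_upwards [hpot.ae_supTransform_eq hGi hμν hΛ hΛR hdom,
      ae_hasGradientAt hpot.lipschitz (hnd c)] with x h1 h2
    exact (gradient_mem_closure_and_subgradient hdom h1 h2).1
  -- The gradient lies in `closure Λ` only almost everywhere; the value `0` elsewhere secures the
  -- constraint at every point.
  let u : α → E := fun x => if ∇ ψ (G x) ∈ closure Λ then ∇ ψ (G x) else 0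
  have hug : u =ᵐ[μ] fun x => ∇ ψ (G x) := by
    filter_upwards [hgΛ] with x hx
    exact if_pos hx
  have huΛ : ∀ x, u x ∈ closure Λ := fun x => by
    by_cases h : ∇ ψ (G x) ∈ closure Λ
    · simp [u, h]
    · simpa [u, h] using h0Λ
  have huT : ∫ x, ⟪G x, u x⟫ ∂μ = ∫ x, ψ (G x) ∂μ + (∫⁻ y, conj ψ y ∂ν).toReal := by
    rw [← hpot.integral_inner_gradient hGi hμν hΛ hΛR hdom (hnd c)]
    exact integral_congr_ae (hug.mono fun x hx => by simp only [hx])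
  refine ⟨c, u, (ENNReal.add_ne_top.1 hmin.finite).2, hgm.congr hug.symm, huΛ, ?_,
    fun b hb => ?_, fun v hv hint hmap => ?_⟩
  · rw [Measure.map_congr hug]
    exact hpot.map_gradient hGi hμν hΛ hΛR hdom (hnd c)
  · refine (hmin.sub_le hF hD hΦ hlsc hconv (hnd c) hb).trans (le_of_eq ?_)
    exact integral_congr_ae (hug.mono fun x hx => by simp only [hx, hG])
  · have h := integral_inner_le_and_eq hpot.lipschitz hpot.finite hGi (hnd c) hv hmap hint
    rw [huT]
    exact ⟨h.1, fun heq => (h.2 heq).trans hug.symm⟩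

end JointMinimum

/-! ### The Legendre transform, shifted to be nonnegative -/

section Legendre

variable {d : ℕ} {f : Mat d → ℝ} {m : ℝ}

/-- The Legendre transform shifted by a constant, as a function with values in `[0, ∞]`. -/
noncomputable def shiftedConj (f : Mat d → ℝ) (m : ℝ) (η : Mat d) : ℝ≥0∞ :=
  ⨆ ξ, ENNReal.ofReal (⟪ξ, η⟫ - f ξ + m)

lemma lowerSemicontinuous_shiftedConj (f : Mat d → ℝ) (m : ℝ) :
    LowerSemicontinuous (shiftedConj f m) :=
  lowerSemicontinuous_iSup fun ξ =>
    (ENNReal.continuous_ofReal.comp (by fun_prop)).lowerSemicontinuous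

lemma measurable_legendre (f : Mat d → ℝ) : Measurable (legendre f) := by
  refine LowerSemicontinuous.measurable (lowerSemicontinuous_iSup fun ξ => ?_)
  exact (continuous_coe_real_ereal.comp (by fun_prop)).lowerSemicontinuous

lemma shiftedConj_convex (f : Mat d → ℝ) (m : ℝ) (a b : Mat d) (t : ℝ) (h0 : 0 ≤ t) (h1 : t ≤ 1) :
    shiftedConj f m ((1 - t) • a + t • b)
      ≤ ENNReal.ofReal (1 - t) * shiftedConj f m a + ENNReal.ofReal t * shiftedConj f m b := by
  refine iSup_le fun ξ => ?_
  have h : ⟪ξ, (1 - t) • a + t • b⟫ - f ξ + m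
      = (1 - t) * (⟪ξ, a⟫ - f ξ + m) + t * (⟪ξ, b⟫ - f ξ + m) := by
    rw [inner_add_right, real_inner_smul_right, real_inner_smul_right]; ring
  rw [h]
  refine ENNReal.ofReal_add_le.trans ?_
  rw [ENNReal.ofReal_mul (sub_nonneg.2 h1), ENNReal.ofReal_mul h0]
  gcongr
  · exact le_iSup (fun ξ => ENNReal.ofReal (⟪ξ, a⟫ - f ξ + m)) ξ
  · exact le_iSup (fun ξ => ENNReal.ofReal (⟪ξ, b⟫ - f ξ + m)) ξ

lemma isSuperlinear_shiftedConj (hm : 0 ≤ m)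
    (hf : ∀ A : ℝ, 0 ≤ A → ∃ C : ℝ, 0 ≤ C ∧ ∀ ξ, ‖ξ‖ ≤ A → f ξ ≤ C) :
    IsSuperlinear (shiftedConj f m) := by
  intro A hA
  obtain ⟨C, hC, hfC⟩ := hf A hA
  refine ⟨C, hC, fun η => ?_⟩
  -- The competitor is the vector of length `A` along `η`; for `η = 0` division by zero makes it
  -- `0`.
  have hξ : ‖(A / ‖η‖) • η‖ ≤ A := by
    rw [norm_smul, Real.norm_of_nonneg (by positivity)]
    rcases eq_or_ne ‖η‖ 0 with h | h
    · simpa [h] using hA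
    · rw [div_mul_cancel₀ _ h]
  have hin : ⟪(A / ‖η‖) • η, η⟫ = A * ‖η‖ := by
    rw [real_inner_smul_left, real_inner_self_eq_norm_sq]
    rcases eq_or_ne ‖η‖ 0 with h | h
    · simp [h]
    · field_simp
  calc ENNReal.ofReal (A * ‖η‖)
      ≤ ENNReal.ofReal (⟪(A / ‖η‖) • η, η⟫ - f ((A / ‖η‖) • η) + m + C) :=
        ENNReal.ofReal_le_ofReal (by rw [hin]; linarith [hfC _ hξ])
    _ ≤ _ := ENNReal.ofReal_add_le
    _ ≤ _ := add_le_add_left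
        (le_iSup (fun ξ => ENNReal.ofReal (⟪ξ, η⟫ - f ξ + m)) ((A / ‖η‖) • η)) _

lemma shiftedConj_eq (f : Mat d → ℝ) (m : ℝ) (η : Mat d) :
    shiftedConj f m η = (legendre f η + (m : EReal)).toENNReal := by
  have hmono : Monotone fun x : EReal => (x + (m : EReal)).toENNReal := fun x y hxy =>
    EReal.toENNReal_le_toENNReal (add_le_add_left hxy _)
  have hcont : ContinuousAt (fun x : EReal => (x + (m : EReal)).toENNReal) (legendre f η) := by
    refine ContinuousAt.ereal_toENNReal ?_
    exact (EReal.continuousAt_add (p := (legendre f η, (m : EReal))) (by simp) (by simp)).comp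
      (f := fun x : EReal => (x, (m : EReal))) (by fun_prop)
  exact (hmono.map_iSup_of_continuousAt hcont (by simp)).symm

/-- The identity `a⁺ + m = a⁻ + (a + m)` avoids subtraction and so survives `a = ∞`. -/
lemma toENNReal_add_eq {a : EReal} (hm : 0 ≤ m) (ha : ((-m : ℝ) : EReal) ≤ a) :
    a.toENNReal + ENNReal.ofReal m = (-a).toENNReal + (a + (m : EReal)).toENNReal := by
  induction a with
  | bot => simp at ha
  | top => simp
  | coe a =>
    rw [EReal.coe_le_coe_iff] at ha
    rw [← EReal.coe_neg, ← EReal.coe_add, EReal.real_coe_toENNReal, EReal.real_coe_toENNReal,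
      EReal.real_coe_toENNReal]
    rcases le_total 0 a with h | h
    · rw [ENNReal.ofReal_of_nonpos (neg_nonpos.2 h), zero_add, ENNReal.ofReal_add h hm]
    · rw [ENNReal.ofReal_of_nonpos h, zero_add, ← ENNReal.ofReal_add (by linarith) (by linarith)]
      congr 1
      ring

lemma neg_le_legendre (hm : |f 0| ≤ m) (η : Mat d) : ((-m : ℝ) : EReal) ≤ legendre f η := by
  refine le_trans ?_ (le_iSup (fun ξ : Mat d => ((inner ℝ ξ η - f ξ : ℝ) : EReal)) 0)
  rw [EReal.coe_le_coe_iff, inner_zero_left]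
  linarith [(abs_le.1 hm).1, le_abs_self (f 0)]

lemma extIntegral_legendre {α : Type*} [MeasurableSpace α] {μ : Measure α} [IsFiniteMeasure μ]
    (hm : |f 0| ≤ m) {φ : α → Mat d} (hφ : AEMeasurable φ μ) :
    extIntegral μ (fun x => legendre f (φ x))
      = ((∫⁻ x, shiftedConj f m (φ x) ∂μ : ℝ≥0∞) : EReal) - ((m * μ.real univ : ℝ) : EReal) := by
  have hm0 : 0 ≤ m := (abs_nonneg _).trans hm
  have hleg : AEMeasurable (fun x => legendre f (φ x)) μ :=
    (measurable_legendre f).comp_aemeasurable hφ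
  have hneg : AEMeasurable (fun x => (-legendre f (φ x)).toENNReal) μ :=
    (measurable_ereal_toENNReal.comp continuous_neg.measurable).comp_aemeasurable hleg
  have hsum : ∫⁻ x, (legendre f (φ x)).toENNReal ∂μ + ENNReal.ofReal m * μ univ
      = ∫⁻ x, (-legendre f (φ x)).toENNReal ∂μ + ∫⁻ x, shiftedConj f m (φ x) ∂μ := by
    rw [← lintegral_const, ← lintegral_add_right _ measurable_const, ← lintegral_add_left' hneg]
    refine lintegral_congr fun x => ?_
    rw [shiftedConj_eq, toENNReal_add_eq hm0 (neg_le_legendre hm _)]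
  -- The negative part has finite integral, so the difference defining `extIntegral` is never `∞ -
  -- ∞`.
  have hN : ∫⁻ x, (-legendre f (φ x)).toENNReal ∂μ ≤ ENNReal.ofReal m * μ univ := by
    rw [← lintegral_const]
    refine lintegral_mono fun x => ?_
    rw [← EReal.real_coe_toENNReal]
    refine EReal.toENNReal_le_toENNReal (EReal.neg_le.1 ?_)
    simpa using neg_le_legendre hm (φ x)
  have hK : ENNReal.ofReal m * μ univ ≠ ⊤ :=
    ENNReal.mul_ne_top ENNReal.ofReal_ne_top (measure_ne_top _ _)
  have hKr : (ENNReal.ofReal m * μ univ).toReal = m * μ.real univ := by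
    rw [ENNReal.toReal_mul, ENNReal.toReal_ofReal hm0, Measure.real]
  rw [extIntegral, ← hKr, EReal.coe_ennreal_toReal hK]
  generalize ∫⁻ x, (legendre f (φ x)).toENNReal ∂μ = P at *
  generalize ∫⁻ x, (-legendre f (φ x)).toENNReal ∂μ = N at *
  generalize ∫⁻ x, shiftedConj f m (φ x) ∂μ = I at *
  generalize ENNReal.ofReal m * μ univ = K at *
  have hNf := ne_top_of_le_ne_top hK hN
  lift N to ℝ≥0 using hNf
  lift K to ℝ≥0 using hK
  induction I with
  | top =>
    have hP : P = ⊤ := by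
      by_contra hP
      lift P to ℝ≥0 using hP
      simp at hsum
    rw [hP]
    rfl
  | coe I =>
    have hP : P ≠ ⊤ := by
      rintro rfl
      simp at hsum
      exact ENNReal.coe_ne_top hsum.symm
    lift P to ℝ≥0 using hP
    have h : (P : ℝ) + K = N + I := by exact_mod_cast hsum
    have : ((P : ℝ) : EReal) - ((N : ℝ) : EReal) = ((I : ℝ) : EReal) - ((K : ℝ) : EReal) := by
      rw [← EReal.coe_sub, ← EReal.coe_sub, EReal.coe_eq_coe_iff]
      linarith
    exact this

end Legendre

/-! ### Choosing representatives linear in the parameter at every point -/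

section Representation

variable {α : Type*} [MeasurableSpace α] {μ : Measure α} [IsFiniteMeasure μ]
  {X : Type*} [NormedAddCommGroup X] [NormedSpace ℝ X] [FiniteDimensional ℝ X]
  {V : Type*} [NormedAddCommGroup V] [NormedSpace ℝ V] {p : ℝ≥0∞} [Fact (1 ≤ p)]

/-- A linear map from a finite-dimensional space to `L^p` has pointwise linear representatives. -/
lemma exists_pointwise_linear (T : X →ₗ[ℝ] Lp V p μ) :
    ∃ Φ : α → X →L[ℝ] V, Integrable Φ μ ∧ ∀ c, ∀ᵐ x ∂μ, Φ x c = T c x := by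
  obtain ⟨b⟩ : Nonempty (Module.Basis (Fin (Module.finrank ℝ X)) ℝ X) := ⟨Module.finBasis ℝ X⟩
  obtain ⟨L, hL⟩ : ∃ L : Fin (Module.finrank ℝ X) → X →L[ℝ] ℝ, ∀ i c, L i c = b.repr c i :=
    ⟨fun i => (b.coord i).toContinuousLinearMap, fun i c => rfl⟩
  let g : Fin (Module.finrank ℝ X) → α → V := fun i => T (b i)
  let Φ : α → X →L[ℝ] V := fun x => ∑ i, ContinuousLinearMap.smulRight (L i) (g i x)
  refine ⟨Φ, ?_, fun c => ?_⟩
  · have hi : ∀ i, Integrable (fun x => ContinuousLinearMap.smulRight (L i) (g i x)) μ := by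
      intro i
      have hg : Integrable (g i) μ := (Lp.memLp (T (b i))).integrable Fact.out
      exact ((ContinuousLinearMap.smulRightL ℝ X V) (L i)).integrable_comp hg
    exact integrable_finsetSum Finset.univ
      (f := fun i x => ContinuousLinearMap.smulRight (L i) (g i x)) fun i _ => hi i
  · have h1 : T c = ∑ i, b.repr c i • T (b i) := by
      conv_lhs => rw [← b.sum_repr c, map_sum]
      simp only [map_smul]
    have h2 : ∀ᵐ x ∂μ, ∀ i, (b.repr c i • T (b i) : Lp V p μ) x = b.repr c i • T (b i) x :=
      ae_all_iff.2 fun i => Lp.coeFn_smul _ _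
    have h3 : ∀ᵐ x ∂μ, (∑ i, b.repr c i • T (b i) : Lp V p μ) x
        = ∑ i, (b.repr c i • T (b i) : Lp V p μ) x := by
      have := Lp.coeFn_finsetSum Finset.univ (fun i => (b.repr c i • T (b i) : Lp V p μ))
      filter_upwards [this] with x hx
      simpa using hx
    filter_upwards [h2, h3] with x hx2 hx3
    rw [h1, hx3]
    simp [hx2, hL, Φ, g]

end Representation

/-! ### Measure preservation from compactly supported tests -/

section Pushforward

variable {E : Type*} [NormedAddCommGroup E] [InnerProductSpace ℝ E] [FiniteDimensional ℝ E]
  [MeasurableSpace E] [BorelSpace E] {α : Type*} [MeasurableSpace α] {μ : Measure α}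
  [IsFiniteMeasure μ] {ν : Measure E} [IsFiniteMeasure ν] {R : ℝ}

/-- All mass lies in one ball, so a bounded continuous test function can be multiplied by a
compactly supported cutoff without changing either integral. -/
lemma map_eq_of_forall_integral_eq {v : α → E} (hv : AEMeasurable v μ)
    (hvR : ∀ᵐ x ∂μ, ‖v x‖ ≤ R) (hνR : ∀ᵐ y ∂ν, ‖y‖ ≤ R)
    (h : ∀ l : E → ℝ, Continuous l → HasCompactSupport l → ∫ x, l (v x) ∂μ = ∫ y, l y ∂ν) :
    μ.map v = ν := by
  obtain ⟨χ, hχ1, -, hχc, -⟩ := exists_continuous_one_zero_of_isCompact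
    (isCompact_closedBall (0 : E) R) isClosed_empty (disjoint_empty _)
  refine ext_of_forall_integral_eq_of_IsFiniteMeasure fun l => ?_
  rw [integral_map hv l.continuous.aestronglyMeasurable]
  have hχ : ∀ y : E, ‖y‖ ≤ R → l y = χ y * l y := fun y hy => by
    rw [hχ1 (mem_closedBall_zero_iff.2 hy), Pi.one_apply, one_mul]
  rw [integral_congr_ae (hvR.mono fun x hx => hχ _ hx),
    integral_congr_ae (hνR.mono fun y hy => hχ _ hy)]
  exact h (fun y => χ y * l y) (χ.continuous.mul l.continuous) hχc.mul_right

end Pushforward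

/-! ### Weak gradients and non-degeneracy -/

section Gradient

variable {d : ℕ} {Ω : Set (Vec d)} {q : ℝ} [Fact (1 ≤ ENNReal.ofReal q)]

/-- The frontier of a convex set is null, so testing in the interior suffices even if `Ω` is not
open. -/
lemma ae_mem_interior (hΩ : Convex ℝ Ω) : ∀ᵐ x ∂(volume.restrict Ω), x ∈ interior Ω := by
  have h1 := ae_restrict_mem₀ (hΩ.nullMeasurableSet (μ := (volume : Measure (Vec d))))
  have h2 : ∀ᵐ x ∂(volume.restrict Ω), x ∉ frontier Ω :=
    ae_restrict_of_ae (measure_eq_zero_iff_ae_notMem.1 (hΩ.addHaar_frontier volume))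
  filter_upwards [h1, h2] with x hx hx'
  by_contra h
  exact hx' ⟨subset_closure hx, h⟩

/-- The gradient of a Sobolev field that vanishes almost everywhere vanishes. -/
lemma eq_zero_of_field_eq_zero (hΩ : Convex ℝ Ω) {φ : sobolevZero d Ω q}
    (h : field φ =ᵐ[volume.restrict Ω] 0) : φ = 0 := by
  have hw : IsWeakGradient Ω (field φ) (grad φ) := φ.2.1
  have hloc : LocallyIntegrable (grad φ) (volume.restrict Ω) :=
    (Lp.memLp φ.1.2).locallyIntegrable Fact.out
  have hz : ∀ v : Vec d, ∀ᵐ x ∂(volume.restrict Ω), grad φ x v = 0 := by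
    intro v
    have hl : LocallyIntegrable (fun x => grad φ x v) (volume.restrict Ω) := fun x => by
      obtain ⟨s, hs, hi⟩ := hloc x
      exact ⟨s, hs, Integrable.apply_continuousLinearMap hi v⟩
    -- Fundamental lemma of the calculus of variations: with `φ = 0` the weak gradient integrates to
    -- zero against every test function.
    have h1 := isOpen_interior.ae_eq_zero_of_integral_contDiff_smul_eq_zero (U := interior Ω)
      (μ := volume.restrict Ω) (hl.locallyIntegrableOn _) (fun ψ hψ hc hs => by
        have h2 := hw ψ hψ hc hs v
        rw [integral_eq_zero_of_ae (h.mono fun x hx => by simp [hx])] at h2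
        exact (neg_eq_zero.1 h2.symm))
    filter_upwards [h1, ae_mem_interior hΩ] with x hx hxi using hx hxi
  have hg : grad φ =ᵐ[volume.restrict Ω] 0 := by
    have h1 : ∀ᵐ x ∂(volume.restrict Ω), ∀ i : Fin d, grad φ x (EuclideanSpace.basisFun (Fin d) ℝ i) = 0 :=
      ae_all_iff.2 fun i => hz _
    filter_upwards [h1] with x hx
    refine ContinuousLinearMap.coe_injective ?_
    exact (EuclideanSpace.basisFun (Fin d) ℝ).toBasis.ext fun i => by simpa using hx i
  refine Subtype.ext (Prod.ext ?_ ?_)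
  · exact Lp.ext (h.trans (Lp.coeFn_zero _ _ _).symm)
  · exact Lp.ext (hg.trans (Lp.coeFn_zero _ _ _).symm)

/-- The divergence as a linear function of the gradient. -/
noncomputable def divLinear (d : ℕ) : GradMat d →L[ℝ] Vec d :=
  LinearMap.toContinuousLinearMap
    { toFun := fun A => WithLp.toLp 2 fun i => ∑ j, A (EuclideanSpace.single j 1) (i, j)
      map_add' := fun A B => by ext i; simp [Finset.sum_add_distrib]
      map_smul' := fun t A => by ext i; simp [Finset.mul_sum] }

lemma divLinear_grad (φ : sobolevZero d Ω q) (x : Vec d) :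
    divLinear d (grad φ x) = divergence φ x := rfl

/-- On each piece where `∇φ = A`, the map is `F` translated by a constant; a countable union of null
sets is null. -/
lemma conditionND_of_countable (hΩ : Convex ℝ Ω) {F : Vec d → Vec d} (hF : NonDegenerate Ω F)
    {S : Set (sobolevZero d Ω q)} (hS : ∀ φ ∈ S, HasCountableGradRange φ) : ConditionND F S := by
  intro φ hφ N hN
  obtain ⟨C, hC, hCae⟩ := hS φ hφ
  have hnull : NullMeasurableSet Ω (volume : Measure (Vec d)) :=
    hΩ.nullMeasurableSet (μ := (volume : Measure (Vec d)))
  rw [inter_comm, ← Measure.restrict_apply₀' hnull]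
  have h1 : ∀ A ∈ C, ∀ᵐ x ∂(volume.restrict Ω), F x + divLinear d A ∉ N := by
    intro A _
    have h2 := hF ((fun y => y + divLinear d A) ⁻¹' N) (by rw [measure_preimage_add_right, hN])
    rw [inter_comm, ← Measure.restrict_apply₀' hnull] at h2
    exact measure_eq_zero_iff_ae_notMem.1 h2
  refine measure_eq_zero_iff_ae_notMem.2 ?_
  filter_upwards [(ae_ball_iff hC).2 h1, hCae] with x hx hxC
  exact hx _ hxC

end Gradient

/-! ### From dual optimality to the unique minimizer -/

section Main

variable {d : ℕ} {Ω Λ : Set (Vec d)} {p q : ℝ} [Fact (1 ≤ ENNReal.ofReal q)] {f : Mat d → ℝ}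
  {S : Submodule ℝ (sobolevZero d Ω q)}

lemma exists_injective_parametrization {X : Type*} [AddCommGroup X] [Module ℝ X]
    (S : Submodule ℝ X) [FiniteDimensional ℝ S] :
    ∃ (n : ℕ) (σ : (Fin n → ℝ) →ₗ[ℝ] X), (∀ w, σ w ∈ S) ∧ (∀ φ ∈ S, ∃ w, σ w = φ) ∧
      ∀ w, σ w = 0 → w = 0 := by
  let τ := (Module.finBasis ℝ S).equivFun.symm
  exact ⟨_, S.subtype ∘ₗ τ.toLinearMap, fun w => (τ w).2,
    fun φ hφ => ⟨τ.symm ⟨φ, hφ⟩, congrArg Subtype.val (τ.apply_symm_apply ⟨φ, hφ⟩)⟩,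
    fun w hw => τ.map_eq_zero_iff.1 (Subtype.ext hw)⟩

lemma ConditionA1.exists_bound {T : Set (sobolevZero d Ω q)} (hp : 0 < p) (hf : ConditionA1 p f T)
    {A : ℝ} (hA : 0 ≤ A) : ∃ C : ℝ, 0 ≤ C ∧ ∀ ξ, ‖ξ‖ ≤ A → f ξ ≤ C := by
  obtain ⟨a, b, c, -, hb, hc, h, -⟩ := hf.growth
  refine ⟨c * (A ^ p / p) + b, by positivity, fun ξ hξ => (h ξ).2.trans ?_⟩
  gcongr

lemma aemeasurable_field (φ : sobolevZero d Ω q) : AEMeasurable (field φ) (volume.restrict Ω) :=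
  (Lp.aestronglyMeasurable φ.1.1).aemeasurable

lemma integrable_divergence [IsFiniteMeasure (volume.restrict Ω)] (φ : sobolevZero d Ω q) :
    Integrable (divergence φ) (volume.restrict Ω) :=
  (divLinear d).integrable_comp ((Lp.memLp φ.1.2).integrable Fact.out)

lemma integrable_inner_of_bounded {α E : Type*} [MeasurableSpace α] {μ : Measure α}
    [NormedAddCommGroup E] [InnerProductSpace ℝ E] {u G : α → E} {R : ℝ}
    (hu : AEStronglyMeasurable u μ) (huR : ∀ᵐ x ∂μ, ‖u x‖ ≤ R) (hG : Integrable G μ) :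
    Integrable (fun x => ⟪u x, G x⟫) μ := by
  refine (hG.norm.const_mul R).mono' (hu.inner hG.1) (huR.mono fun x hx => ?_)
  exact (norm_inner_le_norm _ _).trans (mul_le_mul_of_nonneg_right hx (norm_nonneg _))

/-- The map `φ ↦ φ` from `W_0^{1,q}` to `L^q`. -/
noncomputable def fieldLinear (d : ℕ) (Ω : Set (Vec d)) (q : ℝ) [Fact (1 ≤ ENNReal.ofReal q)] :
    sobolevZero d Ω q →ₗ[ℝ] Lp (Mat d) (ENNReal.ofReal q) (volume.restrict Ω) :=
  LinearMap.fst ℝ _ _ ∘ₗ (sobolevZero d Ω q).subtype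

/-- The map `φ ↦ ∇φ` from `W_0^{1,q}` to `L^q`. -/
noncomputable def gradLinear (d : ℕ) (Ω : Set (Vec d)) (q : ℝ) [Fact (1 ≤ ENNReal.ofReal q)] :
    sobolevZero d Ω q →ₗ[ℝ] Lp (GradMat d) (ENNReal.ofReal q) (volume.restrict Ω) :=
  LinearMap.snd ℝ _ _ ∘ₗ (sobolevZero d Ω q).subtype

/-- On a finite-dimensional space of fields, `φ ↦ ∫ u · div φ` is bounded in the `L^q` norm. -/
lemma exists_bound_integral_inner_divergence [FiniteDimensional ℝ S]
    [IsFiniteMeasure (volume.restrict Ω)] (hΩ : Convex ℝ Ω) {u : Vec d → Vec d} {R : ℝ}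
    (hu : AEMeasurable u (volume.restrict Ω)) (huR : ∀ᵐ x ∂(volume.restrict Ω), ‖u x‖ ≤ R) :
    ∃ c : ℝ, 0 < c ∧ ∀ φ ∈ (S : Set (sobolevZero d Ω q)),
      |∫ x in Ω, inner ℝ (u x) (divergence φ x)| ≤ c * ‖φ.1.1‖ := by
  have hi : ∀ φ : sobolevZero d Ω q,
      Integrable (fun x => ⟪u x, divergence φ x⟫) (volume.restrict Ω) := fun φ =>
    integrable_inner_of_bounded hu.aestronglyMeasurable huR (integrable_divergence φ)
  have hadd : ∀ φ χ : sobolevZero d Ω q, divergence (φ + χ) =ᵐ[volume.restrict Ω]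
      fun x => divergence φ x + divergence χ x := fun φ χ => by
    filter_upwards [Lp.coeFn_add φ.1.2 χ.1.2] with x hx
    rw [← divLinear_grad, ← divLinear_grad, ← divLinear_grad, ← map_add]
    exact congrArg _ hx
  have hsmul : ∀ (t : ℝ) (φ : sobolevZero d Ω q), divergence (t • φ) =ᵐ[volume.restrict Ω]
      fun x => t • divergence φ x := fun t φ => by
    filter_upwards [Lp.coeFn_smul t φ.1.2] with x hx
    rw [← divLinear_grad, ← divLinear_grad, ← map_smul]
    exact congrArg _ hx
  let L : sobolevZero d Ω q →ₗ[ℝ] ℝ :=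
    { toFun := fun φ => ∫ x in Ω, ⟪u x, divergence φ x⟫
      map_add' := fun φ χ => by
        rw [← integral_add (hi φ) (hi χ)]
        refine integral_congr_ae ?_
        filter_upwards [hadd φ χ] with x hx
        rw [hx, inner_add_right]
      map_smul' := fun t φ => by
        rw [RingHom.id_apply, smul_eq_mul, ← integral_const_mul]
        refine integral_congr_ae ?_
        filter_upwards [hsmul t φ] with x hx
        rw [hx, real_inner_smul_right] }
  obtain ⟨n, σ, -, hσ, hσ0⟩ := exists_injective_parametrization S
  let P : (Fin n → ℝ) →ₗ[ℝ] Lp (Mat d) (ENNReal.ofReal q) (volume.restrict Ω) :=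
    fieldLinear d Ω q ∘ₗ σ
  let A : (Fin n → ℝ) →ₗ[ℝ] ℝ := L ∘ₗ σ
  -- A field determines its gradient, so the `L^q` norm of the field alone is a norm on `S`, and
  -- every linear functional on `S` is bounded by it.
  have hP : LinearMap.ker P = ⊥ := by
    refine LinearMap.ker_eq_bot'.2 fun w hw => hσ0 w (eq_zero_of_field_eq_zero hΩ ?_)
    have h2 : (σ w).1.1 = 0 := hw
    rw [field, h2]
    exact Lp.coeFn_zero _ _ _
  obtain ⟨K, hK, hPK⟩ := P.exists_antilipschitzWith hP
  refine ⟨‖A.toContinuousLinearMap‖ * K + 1, by positivity, fun φ hφ => ?_⟩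
  obtain ⟨w, hw⟩ := hσ φ hφ
  have h1 := A.toContinuousLinearMap.le_opNorm w
  have h2 := hPK.le_mul_dist w 0
  rw [map_zero, dist_zero_right, dist_zero_right] at h2
  have h3 : ‖P w‖ = ‖φ.1.1‖ := by rw [← hw]; rfl
  have h5 : A.toContinuousLinearMap w = ∫ x in Ω, inner ℝ (u x) (divergence φ x) := by
    rw [← hw]; rfl
  rw [h3] at h2
  rw [h5, Real.norm_eq_abs] at h1
  have h4 := h1.trans (mul_le_mul_of_nonneg_left h2 (norm_nonneg _))
  nlinarith [norm_nonneg φ.1.1]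

/-- A map with the optimality conditions of `exists_optimal_map` is the unique minimizer. -/
lemma exists_unique_minimizer_of_optimal_map [FiniteDimensional ℝ S]
    [IsFiniteMeasure (volume.restrict Ω)] [IsFiniteMeasure (volume.restrict Λ)]
    {F : Vec d → Vec d} {R : ℝ} (hF : IntegrableOn F Ω) (hΩ : Convex ℝ Ω)
    (hΛR : ∀ᵐ y ∂(volume.restrict Λ), ‖y‖ ≤ R)
    (hR : ∀ v : Vec d → Vec d, (∀ x ∈ Ω, v x ∈ closure Λ) →
      ∀ᵐ x ∂(volume.restrict Ω), ‖v x‖ ≤ R)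
    {χ : sobolevZero d Ω q} (hχ : χ ∈ S) {δ : Vec d → Vec d}
    (hδ : ∀ᵐ x ∂(volume.restrict Ω), δ x = divergence χ x) {e : ℝ}
    (he : conjEnergy f χ = (e : EReal)) {u : Vec d → Vec d}
    (hu : AEMeasurable u (volume.restrict Ω)) (huΛ : ∀ x ∈ Ω, u x ∈ closure Λ)
    (hmap : (volume.restrict Ω).map u = volume.restrict Λ)
    (hvar : ∀ φ ∈ S, ((e - ((∫ x in Ω, inner ℝ (u x) (divergence φ x))
      - ∫ x in Ω, inner ℝ (u x) (divergence χ x)) : ℝ) : EReal) ≤ conjEnergy f φ)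
    (hopt : ∀ v : Vec d → Vec d, AEMeasurable v (volume.restrict Ω) →
      Integrable (fun x => inner ℝ (F x + δ x) (v x)) (volume.restrict Ω) →
      (volume.restrict Ω).map v = volume.restrict Λ →
      ∫ x in Ω, inner ℝ (F x + δ x) (v x) ≤ ∫ x in Ω, inner ℝ (F x + δ x) (u x) ∧
      (∫ x in Ω, inner ℝ (F x + δ x) (v x) = ∫ x in Ω, inner ℝ (F x + δ x) (u x) →
        v =ᵐ[volume.restrict Ω] u)) :
    ∃ u : Vec d → Vec d,
      IsIncompressibleMinimizer Λ f F (S : Set (sobolevZero d Ω q)) u ∧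
      ∀ v : Vec d → Vec d,
        IsIncompressibleMinimizer Λ f F (S : Set (sobolevZero d Ω q)) v →
          v =ᵐ[volume.restrict Ω] u := by
  have hpair : ∀ v : Vec d → Vec d, AEMeasurable v (volume.restrict Ω) →
      (∀ x ∈ Ω, v x ∈ closure Λ) →
      Integrable (fun x => inner ℝ (F x + δ x) (v x)) (volume.restrict Ω) ∧
      ∫ x in Ω, inner ℝ (F x + δ x) (v x)
        = (∫ x in Ω, inner ℝ (F x) (v x)) + ∫ x in Ω, inner ℝ (v x) (divergence χ x) := by
    intro v hv hvΛ
    have hi1 : Integrable (fun x => inner ℝ (F x) (v x)) (volume.restrict Ω) := by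
      simpa only [real_inner_comm] using
        integrable_inner_of_bounded hv.aestronglyMeasurable (hR v hvΛ) hF
    have hi2 := integrable_inner_of_bounded hv.aestronglyMeasurable (hR v hvΛ)
      (integrable_divergence χ)
    have hae : (fun x => inner ℝ (F x + δ x) (v x)) =ᵐ[volume.restrict Ω]
        fun x => inner ℝ (F x) (v x) + inner ℝ (v x) (divergence χ x) := by
      filter_upwards [hδ] with x hx
      rw [hx, inner_add_left, real_inner_comm (v x) (divergence χ x)]
    exact ⟨(hi1.add hi2).congr hae.symm, by rw [integral_congr_ae hae, integral_add hi1 hi2]⟩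
  -- Lower bound: test the supremum `V(v)` with `χ`.
  have hlow : ∀ v ∈ incompressible Λ (S : Set (sobolevZero d Ω q)),
      ((-e - ∫ x in Ω, inner ℝ (F x + δ x) (v x) : ℝ) : EReal) ≤ energy f F (S : Set (sobolevZero d Ω q)) v := by
    intro v hv
    have h1 : (((- ∫ x in Ω, inner ℝ (v x) (divergence χ x) : ℝ) : EReal) - conjEnergy f χ)
        ≤ pseudoEnergy f (S : Set (sobolevZero d Ω q)) v :=
      le_iSup₂ (f := fun (φ : sobolevZero d Ω q) (_ : φ ∈ (S : Set (sobolevZero d Ω q))) =>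
        (((- ∫ x in Ω, inner ℝ (v x) (divergence φ x) : ℝ) : EReal) - conjEnergy f φ)) χ hχ
    rw [he, ← EReal.coe_sub] at h1
    rw [(hpair v hv.1.1 hv.1.2.1).2]
    refine le_trans (le_of_eq ?_) (EReal.sub_le_sub h1 le_rfl)
    rw [← EReal.coe_sub, EReal.coe_eq_coe_iff]
    ring
  -- By `hvar`, `χ` attains the supremum `V(u)`, so the lower bound is sharp at `u`.
  have hval : energy f F (S : Set (sobolevZero d Ω q)) u
      ≤ ((-e - ∫ x in Ω, inner ℝ (F x + δ x) (u x) : ℝ) : EReal) := by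
    have h1 : pseudoEnergy f (S : Set (sobolevZero d Ω q)) u
        ≤ ((-(∫ x in Ω, inner ℝ (u x) (divergence χ x)) - e : ℝ) : EReal) := by
      refine iSup₂_le fun φ hφ => (EReal.sub_le_sub le_rfl (hvar φ hφ)).trans (le_of_eq ?_)
      rw [← EReal.coe_sub, EReal.coe_eq_coe_iff]
      ring
    refine (EReal.sub_le_sub h1 le_rfl).trans (le_of_eq ?_)
    rw [← EReal.coe_sub, EReal.coe_eq_coe_iff, (hpair u hu huΛ).2]
    ring
  have huinc : u ∈ incompressible Λ (S : Set (sobolevZero d Ω q)) := by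
    refine ⟨⟨hu, huΛ, exists_bound_integral_inner_divergence hΩ hu (hR u huΛ)⟩, fun l hl _ => ?_⟩
    rw [← hmap, integral_map hu hl.aestronglyMeasurable]
  have hweak := fun v (hv : v ∈ incompressible Λ (S : Set (sobolevZero d Ω q))) =>
    hopt v hv.1.1 (hpair v hv.1.1 hv.1.2.1).1
      (map_eq_of_forall_integral_eq hv.1.1 (hR v hv.1.2.1) hΛR hv.2)
  refine ⟨u, ⟨huinc, fun v hv => ?_⟩, fun v hv => ?_⟩
  · refine hval.trans (le_trans ?_ (hlow v hv))
    rw [EReal.coe_le_coe_iff]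
    linarith [(hweak v hv).1]
  · have h1 := (hlow v hv.1).trans ((hv.2 u huinc).trans hval)
    rw [EReal.coe_le_coe_iff] at h1
    exact (hweak v hv.1).2 (le_antisymm (hweak v hv.1).1 (by linarith))

end Main

end PseudoGradient

open PseudoGradient
set_option maxHeartbeats 2000000 in
theorem corollary4p5 (d : ℕ) (Ω Λ : Set (Vec d))
    (hΩ : Convex ℝ Ω) (hΩb : Bornology.IsBounded Ω) (hΛ : Convex ℝ Λ)
    (r : ℝ) (hr : 1 < r) (hrΛ : Metric.ball 0 (1 / r) ⊆ Λ) (hΛr : Λ ⊆ Metric.ball 0 (r / 2))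
    (hvol : volume Ω = volume Λ)
    (p q : ℝ) (hpq : p.HolderConjugate q) [Fact (1 ≤ ENNReal.ofReal q)]
    (S : Submodule ℝ (sobolevZero d Ω q)) [FiniteDimensional ℝ S]
    (hS : ∀ φ ∈ S, HasCountableGradRange φ)
    (f : Mat d → ℝ) (hf : ConditionA1 p f (S : Set (sobolevZero d Ω q)))
    (F : Vec d → Vec d) (hF : IntegrableOn F Ω) (hFnd : NonDegenerate Ω F) :
    ConditionND F (S : Set (sobolevZero d Ω q)) ∧
    ∃ u : Vec d → Vec d,
      IsIncompressibleMinimizer Λ f F (S : Set (sobolevZero d Ω q)) u ∧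
      ∀ v : Vec d → Vec d,
        IsIncompressibleMinimizer Λ f F (S : Set (sobolevZero d Ω q)) v →
          v =ᵐ[volume.restrict Ω] u := by
  have hND : ConditionND F (S : Set (sobolevZero d Ω q)) := conditionND_of_countable hΩ hFnd hS
  refine ⟨hND, ?_⟩
  have hΛb : Bornology.IsBounded Λ := Metric.isBounded_ball.subset hΛr
  have : IsFiniteMeasure ((volume : Measure (Vec d)).restrict Ω) :=
    isFiniteMeasure_restrict.2 hΩb.measure_lt_top.ne
  have : IsFiniteMeasure ((volume : Measure (Vec d)).restrict Λ) :=
    isFiniteMeasure_restrict.2 hΛb.measure_lt_top.ne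
  set μ : Measure (Vec d) := volume.restrict Ω with hμ
  set ν : Measure (Vec d) := volume.restrict Λ with hν
  have hΩm : NullMeasurableSet Ω (volume : Measure (Vec d)) := hΩ.nullMeasurableSet (μ := volume)
  have hΛm : NullMeasurableSet Λ (volume : Measure (Vec d)) := hΛ.nullMeasurableSet (μ := volume)
  have hμν : ν univ = μ univ := by simp [hμ, hν, hvol]
  have hΛae : ∀ᵐ y ∂ν, y ∈ Λ := ae_restrict_mem₀ hΛm
  let R : NNReal := ⟨r / 2, by linarith⟩
  have hΛR : ∀ y ∈ Λ, ‖y‖ ≤ R := fun y hy => (mem_ball_zero_iff.1 (hΛr hy)).le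
  have hΛcR : ∀ y ∈ closure Λ, ‖y‖ ≤ R := fun y hy => by
    have h1 : closure Λ ⊆ Metric.closedBall 0 R :=
      closure_minimal (fun y hy => mem_closedBall_zero_iff.2 (hΛR y hy)) Metric.isClosed_closedBall
    exact mem_closedBall_zero_iff.1 (h1 hy)
  have h0Λ : (0 : Vec d) ∈ closure Λ :=
    subset_closure (hrΛ (Metric.mem_ball_self (by positivity)))
  have hν0 : ν ≠ 0 := by
    intro h
    have h1 : volume Λ = 0 := by simpa [hν] using congrArg (fun m : Measure (Vec d) => m univ) h
    have h2 : 0 < volume (Metric.ball (0 : Vec d) (1 / r)) :=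
      Metric.measure_ball_pos _ _ (by positivity)
    exact absurd (measure_mono_null hrΛ h1) h2.ne'
  obtain ⟨n, σ, hσS, hσ, hσ0⟩ := exists_injective_parametrization S
  obtain ⟨Φ, hΦ, hΦeq⟩ := exists_pointwise_linear (fieldLinear d Ω q ∘ₗ σ)
  obtain ⟨Γ, hΓ, hΓeq⟩ := exists_pointwise_linear (gradLinear d Ω q ∘ₗ σ)
  have hΦeq : ∀ w, ∀ᵐ x ∂μ, Φ x w = field (σ w) x := hΦeq
  let D : Vec d → (Fin n → ℝ) →L[ℝ] Vec d := fun x => (divLinear d).comp (Γ x)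
  have hD : Integrable D μ :=
    (ContinuousLinearMap.compL ℝ (Fin n → ℝ) (GradMat d) (Vec d) (divLinear d)).integrable_comp hΓ
  have hDeq : ∀ w, ∀ᵐ x ∂μ, D x w = divergence (σ w) x := fun w => by
    filter_upwards [hΓeq w] with x hx
    exact congrArg (divLinear d) hx
  have hinj : ∀ w, (∀ᵐ x ∂μ, Φ x w = 0) → w = 0 := fun w hw => by
    refine hσ0 w (eq_zero_of_field_eq_zero hΩ ?_)
    filter_upwards [hw, hΦeq w] with x h1 h2
    rw [← h2, h1, Pi.zero_apply]
  -- Since `f^* ≥ -f 0`, the shift by `|f 0|` makes `f^*` nonnegative; it changes all energies by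
  -- the same constant `K`.
  set m : ℝ := |f 0| with hm
  let e : Mat d → ENNReal := shiftedConj f m
  let K : ℝ := m * μ.real univ
  have hE : ∀ w, conjEnergy f (σ w)
      = ((∫⁻ x, e (Φ x w) ∂μ : ENNReal) : EReal) - ((K : ℝ) : EReal) := fun w => by
    rw [conjEnergy, extIntegral_legendre le_rfl (aemeasurable_field (σ w))]
    congr 2
    exact lintegral_congr_ae ((hΦeq w).mono fun x hx => congrArg e hx.symm)
  have hEtop : ∀ w, ∫⁻ x, e (Φ x w) ∂μ = ⊤ → conjEnergy f (σ w) = ⊤ := fun w h => by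
    rw [hE, h]; rfl
  have hEreal : ∀ w, ∫⁻ x, e (Φ x w) ∂μ ≠ ⊤ →
      conjEnergy f (σ w) = (((∫⁻ x, e (Φ x w) ∂μ).toReal - K : ℝ) : EReal) := fun w h => by
    rw [hE, EReal.coe_sub, EReal.coe_ennreal_toReal h]
  have hfin : ∃ w, ∫⁻ x, e (Φ x w) ∂μ ≠ ⊤ := by
    obtain ⟨φ, hφ, h1, -⟩ := hf.exists_finite
    obtain ⟨w, rfl⟩ := hσ φ hφ
    exact ⟨w, fun h => h1 (hEtop w h)⟩
  have hnd : ∀ (w : Fin n → ℝ) (N : Set (Vec d)), Measure.addHaar N = 0 →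
      μ ((fun x => F x + D x w) ⁻¹' N) = 0 := by
    intro w N hN
    have h1 : volume N = 0 := Measure.absolutelyContinuous_isAddHaarMeasure _ _ hN
    have h2 := hND (σ w) (hσS w) N h1
    rw [inter_comm, ← Measure.restrict_apply₀' hΩm] at h2
    refine measure_eq_zero_iff_ae_notMem.2 ?_
    filter_upwards [measure_eq_zero_iff_ae_notMem.1 h2, hDeq w] with x hx hDx
    rwa [mem_preimage, hDx]
  obtain ⟨c, u, hcfin, hum, huΛ, hmap, hvar, hopt⟩ := exists_optimal_map (μ := μ) (ν := ν) (R := R)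
    hF hD hΦ hinj (isSuperlinear_shiftedConj (abs_nonneg (f 0)) fun A hA => hf.exists_bound hpq.pos hA)
    (lowerSemicontinuous_shiftedConj f m) (shiftedConj_convex f m) hfin hμν hν0 hΛae hΛR h0Λ hnd
  have hRae : ∀ v : Vec d → Vec d, (∀ x ∈ Ω, v x ∈ closure Λ) → ∀ᵐ x ∂μ, ‖v x‖ ≤ R := fun v hv => by
    filter_upwards [ae_restrict_mem₀ hΩm] with x hx using hΛcR _ (hv x hx)
  have huR := hRae u fun x _ => huΛ x
  refine exists_unique_minimizer_of_optimal_map (R := R) hF hΩ (hΛae.mono hΛR) hRae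
    (hσS c) (hDeq c) (e := (∫⁻ x, e (Φ x c) ∂μ).toReal - K) (hEreal c hcfin) hum
    (fun x _ => huΛ x) hmap (fun φ hφ => ?_) hopt
  obtain ⟨w, rfl⟩ := hσ φ hφ
  -- Fields of infinite conjugate energy satisfy the inequality trivially; the first variation
  -- covers the others.
  by_cases htop : ∫⁻ x, e (Φ x w) ∂μ = ⊤
  · rw [hEtop w htop]
    exact le_top
  · rw [hEreal w htop, EReal.coe_le_coe_iff]
    have h3 : ∫ x, inner ℝ (u x) (D x (w - c)) ∂μ
        = ∫ x, inner ℝ (u x) (divergence (σ w) x) ∂μ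
          - ∫ x, inner ℝ (u x) (divergence (σ c) x) ∂μ := by
      rw [← integral_sub
        (integrable_inner_of_bounded hum.aestronglyMeasurable huR (integrable_divergence (σ w)))
        (integrable_inner_of_bounded hum.aestronglyMeasurable huR (integrable_divergence (σ c)))]
      refine integral_congr_ae ?_
      filter_upwards [hDeq c, hDeq w] with x hx1 hx2
      rw [map_sub, hx1, hx2, inner_sub_right]
    have h2 := hvar w htop
    rw [h3] at h2
    change (∫⁻ x, e (Φ x c) ∂μ).toReal - (∫⁻ x, e (Φ x w) ∂μ).toReal ≤ _ at h2
    linarith
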